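/- Let $M>0$, $T>0$, and let $\gamma\in C^2([0,M])$ with $\gamma(x)>0$ on $[0,M]$. For every $z\in\mathbb C$ with $\operatorname{Re}z\le 0$ there is a $C^2$ solution $\Psi(\cdot\,;z)$ of $(\gamma y')'-z^2y=0$ on $[0,M]$ such that, as $|z|\to\infty$, uniformly in $x\in[0,M]$, $$\Psi(x;z)=\gamma(x)^{-1/4}\exp\Big(z\int_0^x\frac{dy}{\sqrt{\gamma(y)}}\Big)\{1+O(1/|z|)\},\qquad \Psi'(x;z)=z\,\gamma(x)^{-3/4}\exp\Big(z\int_0^x\frac{dy}{\sqrt{\gamma(y)}}\Big)\{1+O(1/|z|)\}.$$ Fix any such family $\Psi$ and put $v(x,t)=e^{-z^2t}\Psi(x;z)$. Let $0<a\le M$, $\rho\ge 0$, and let $u$ be any variational (weak) solution, in the space $W(0,T;H^1(0,a),(H^1(0,a))')=\{u\in L^2(0,T;H^1(0,a)):u_t\in L^2(0,T;(H^1(0,a))')\}$ and with $u_x(0,\cdot),u_x(a,\cdot)\in L^2(0,T)$, of $$u_t=(\gamma u_x)_x\ \text{in }(0,a)\times(0,T),\qquad \gamma(a)u_x(a,t)+\rho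 u(a,t)=0\ \text{for }t\in(0,T),\qquad u(x,0)=0\ \text{in }(0,a).$$ Define, for $\operatorname{Re}z\le0$, $$I(z)=\int_0^T\big(-\gamma(0)v_x(0,t)u(0,t)+\gamma(0)u_x(0,t)v(0,t)\big)\,dt.$$ (1) Let $c>0$ satisfy $T>2c\int_0^M\gamma^{-1/2}dx$ and let $z=z(\tau)=-c\tau\big(1+i\sqrt{1-\tfrac1{c^2\tau}}\big)$ for $\tau>c^{-2}$. If there are $C>0$, $\tau_0>c^{-2}$ and $\mu\in\mathbb R$ with $C\tau^\mu\le\big|\int_0^Te^{-z^2t}u_x(0,t)\,dt\big|$ for all $\tau>\tau_0$, then $$\lim_{\tau\to\infty}\frac{\log|I(z)|}{\tau}=-2c\int_0^a\frac{dx}{\sqrt{\gamma(x)}}.$$ (2) If there are $C>0$, $\tau_0>0$ and $\mu\in\mathbb R$ with $C\tau^\mu\le\big|\int_0^Te^{-\tau^2t}u_x(0,t)\,dt\big|$ for all $\tau>\tau_0$, then $$\lim_{\tau\to\infty}\frac{\log|I(-\tau)|}{\tau}=-2\int_0^a\frac{dx}{\sqrt{\gamma(x)}}.$$ Consequently $a$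 is uniquely determined: if $u_1,u_2$ are such solutions for the same $\gamma$, $M$, $T$, with endpoints $a_1,a_2\in(0,M]$ and Robin constants $\rho_1,\rho_2\ge0$, if $u_1(0,t)=u_2(0,t)$ and $(u_1)_x(0,t)=(u_2)_x(0,t)$ for almost every $t\in(0,T)$, and if this common flux satisfies the condition in (1) for some $c>0$ with $T>2c\int_0^M\gamma^{-1/2}dx$ or the condition in (2), then $a_1=a_2$. -/

import Mathlib

open Set Filter Topology MeasureTheory
open scoped ContDiff

namespace HeatEnclosure

noncomputable section

/-- `g` is the distributional derivative of `f` on the open interval `(0, L)`. -/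
def HasWeakDeriv (L : ℝ) (f g : ℝ → ℝ) : Prop :=
  ∀ η : ℝ → ℝ, ContDiff ℝ ∞ η → HasCompactSupport η → tsupport η ⊆ Ioo 0 L →
    ∫ x in Ioo 0 L, f x * deriv η x = -∫ x in Ioo 0 L, g x * η x

/-- `f` belongs to the Sobolev space `H¹(0, a)` with weak derivative `f'`.  As usual in dimension
one, `f` is taken to be the representative that is continuous on `[0, a]`, so that `f 0` and `f a`
are the boundary traces. -/
structure IsH1 (a : ℝ) (f f' : ℝ → ℝ) : Prop where
  continuousOn : ContinuousOn f (Icc 0 a)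
  memLp : MemLp f 2 (volume.restrict (Ioo 0 a))
  memLp_deriv : MemLp f' 2 (volume.restrict (Ioo 0 a))
  weakDeriv : HasWeakDeriv a f f'

/-- `u = u x t` is a variational solution of
`u_t = (γ u_x)_x` in `(0, a) × (0, T)`, `γ(a) u_x(a, t) + ρ u(a, t) = 0`, `u(x, 0) = 0`,
in the space `W(0, T; H¹(0, a), (H¹(0, a))')`.
Here `ux` is the weak derivative `u_x`, and `f₀`, `f₁` are the boundary values `u_x(0, ·)` and
`u_x(a, ·)`, both in `L²(0, T)`; they are attached to `u` by the variational equation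
(integration by parts in `x`).

The elements of `W` are represented by their (unique) representatives that are continuous from
`[0, T]` to `L²(0, a)`.  That `u_t` lies in `L²(0, T; (H¹(0, a))')` is part of `equation`: its
right hand side is, for almost every `t`, a bounded functional of `φ` in `H¹(0, a)` whose norm is
at most a constant times `|f₁ t| + |f₀ t| + ‖ux(·, t)‖_{L²}`. -/
structure IsSolution (γ : ℝ → ℝ) (ρ a T : ℝ) (u ux : ℝ → ℝ → ℝ) (f₀ f₁ : ℝ → ℝ) : Prop where
  memLp : MemLp (fun p : ℝ × ℝ => u p.1 p.2) 2 (volume.restrict (Ioo 0 a ×ˢ Ioo 0 T))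
  memLp_deriv : MemLp (fun p : ℝ × ℝ => ux p.1 p.2) 2 (volume.restrict (Ioo 0 a ×ˢ Ioo 0 T))
  isH1 : ∀ᵐ t ∂(volume.restrict (Ioo 0 T)), IsH1 a (fun x => u x t) (fun x => ux x t)
  memLp_slice : ∀ t ∈ Icc 0 T, MemLp (fun x => u x t) 2 (volume.restrict (Ioo 0 a))
  continuous_slice : ∀ s ∈ Icc 0 T,
    Tendsto (fun t => eLpNorm (fun x => u x t - u x s) 2 (volume.restrict (Ioo 0 a)))
      (𝓝[Icc 0 T] s) (𝓝 0)
  memLp_flux_zero : MemLp f₀ 2 (volume.restrict (Ioo 0 T))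
  memLp_flux_end : MemLp f₁ 2 (volume.restrict (Ioo 0 T))
  /-- For every `φ ∈ H¹(0, a)`, in the sense of distributions on `(0, T)`,
  `d/dt ∫ u φ dx = γ(a) u_x(a, t) φ(a) - γ(0) u_x(0, t) φ(0) - ∫ γ u_x φ' dx`. -/
  equation : ∀ φ φ' : ℝ → ℝ, IsH1 a φ φ' →
    HasWeakDeriv T (fun t => ∫ x in Ioo 0 a, u x t * φ x)
      (fun t => γ a * f₁ t * φ a - γ 0 * f₀ t * φ 0 - ∫ x in Ioo 0 a, γ x * ux x t * φ' x)
  robin : ∀ᵐ t ∂(volume.restrict (Ioo 0 T)), γ a * f₁ t + ρ * u a t = 0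
  initial : ∀ᵐ x ∂(volume.restrict (Ioo 0 a)), u x 0 = 0

/-- `∫₀ˣ dy / √γ(y)`. -/
def travelTime (γ : ℝ → ℝ) (x : ℝ) : ℝ := ∫ y in (0 : ℝ)..x, 1 / √(γ y)

/-- `Ψ z x = Ψ(x; z, M)`, `Re z ≤ 0`, is a family of solutions of `(γ y')' - z² y = 0` on `[0, M]`
with, as `|z| → ∞` and uniformly in `x ∈ [0, M]`,
`Ψ  = γ(x)^(-1/4) exp (z ∫₀ˣ γ^(-1/2)) (1 + O(1/|z|))`,
`Ψ' = z γ(x)^(-3/4) exp (z ∫₀ˣ γ^(-1/2)) (1 + O(1/|z|))`. -/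
structure IsSpecialFamily (γ : ℝ → ℝ) (M : ℝ) (Ψ : ℂ → ℝ → ℂ) : Prop where
  contDiffOn : ∀ z : ℂ, z.re ≤ 0 → ContDiffOn ℝ 2 (Ψ z) (Icc 0 M)
  ode : ∀ z : ℂ, z.re ≤ 0 → ∀ x ∈ Icc 0 M,
    derivWithin (fun y => (γ y : ℂ) * derivWithin (Ψ z) (Icc 0 M) y) (Icc 0 M) x
      - z ^ 2 * Ψ z x = 0
  asymptotics : ∃ K R : ℝ, 0 < R ∧ ∀ z : ℂ, z.re ≤ 0 → R ≤ ‖z‖ → ∀ x ∈ Icc 0 M,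
    ‖Ψ z x / (((γ x ^ (-(1 / 4) : ℝ) : ℝ) : ℂ) * Complex.exp (z * (travelTime γ x : ℂ))) - 1‖
        ≤ K / ‖z‖ ∧
    ‖derivWithin (Ψ z) (Icc 0 M) x /
        (z * ((γ x ^ (-(3 / 4) : ℝ) : ℝ) : ℂ) * Complex.exp (z * (travelTime γ x : ℂ))) - 1‖
        ≤ K / ‖z‖

/-- The solution `v(x, t) = e^{-z² t} Ψ(x; z, M)` of the backward heat equation. -/
def backwardSol (Ψ : ℂ → ℝ → ℂ) (z : ℂ) (x t : ℝ) : ℂ := Complex.exp (-z ^ 2 * t) * Ψ z x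

/-- The indicator function
`I(z) = ∫₀ᵀ (-γ(0) v_x(0, t) u(0, t) + γ(0) u_x(0, t) v(0, t)) dt`,
where `f₀` stands for `u_x(0, ·)`. -/
def indicatorFn (γ : ℝ → ℝ) (M T : ℝ) (Ψ : ℂ → ℝ → ℂ) (u : ℝ → ℝ → ℝ) (f₀ : ℝ → ℝ) (z : ℂ) : ℂ :=
  ∫ t in (0 : ℝ)..T,
    (-(γ 0 : ℂ) * derivWithin (fun x => backwardSol Ψ z x t) (Icc 0 M) 0 * (u 0 t : ℂ)
      + (γ 0 : ℂ) * (f₀ t : ℂ) * backwardSol Ψ z 0 t)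

/-- `z = -c τ (1 + i √(1 - 1 / (c² τ)))`, used for `τ > c⁻²`. -/
def zOf (c τ : ℝ) : ℂ := -(c : ℂ) * τ * (1 + Complex.I * (√(1 - 1 / (c ^ 2 * τ)) : ℝ))

/-- There are `C > 0`, `τ₀ > τmin` and `μ ∈ ℝ` with
`C τ^μ ≤ |∫₀ᵀ e^{-z(τ)² t} f(t) dt|` for all `τ > τ₀`. -/
def FluxLowerBound (T : ℝ) (f : ℝ → ℝ) (z : ℝ → ℂ) (τmin : ℝ) : Prop :=
  ∃ C τ₀ μ : ℝ, 0 < C ∧ τmin < τ₀ ∧ ∀ τ : ℝ, τ₀ < τ →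
    C * τ ^ μ ≤ ‖∫ t in (0 : ℝ)..T, Complex.exp (-(z τ) ^ 2 * t) * (f t : ℂ)‖

end

end HeatEnclosure

/-! Write θ = `travelTime γ`, and call y a mode with flux p = γy' when (γy')' = z²y. Pairing u with
e^{-z²t}y(x) and integrating by parts in x and t makes the interior terms cancel, so only boundary
terms and the final time survive: E = -(p(a) + ρy(a)) U_a - γ(0)y(0) F + p(0) U_0. Here E =
e^{-z²T}∫u(x,T)y dx, while F, U_0, U_a are the finite Laplace transforms over (0,T) of u_x(0,·),
u(0,·), u(a,·). For the decaying mode Ψ ~ e^{zθ} this reads I(z) = -(p(a) + ρΨ(a)) U_a - E.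

The unknown U_a is found from a second mode Φ ~ e^{-zθ}: eliminating U_0 between the two identities
expresses U_a through F and the two terms E. Since p(a) + ρΨ(a) also carries a factor e^{zθ(a)}, the
outcome is I(z) = e^{2zθ(a)} (Q F + r), where Q has an explicit nonzero limit. The remainder r is
exponentially small, because |e^{-z²T}| outweighs e^{2cτθ(M)} for both choices of z. F is bounded by
the L¹ norm of the flux and, by hypothesis, is at least polynomially large, so log|QF + r| = o(τ).
Hence the rate of I is that of e^{2zθ(a)}, namely -2cθ(a). It does not involve ρ, since ρy is
smaller than the flux by a factor 1/z.

Equal boundary data give equal indicator functions, hence θ(a₁) = θ(a₂), and θ is strictly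
increasing.

Two inputs carry the argument. `IsSolution.laplace_identity` rests on the du Bois-Reymond lemma
`HasWeakDeriv.isPrimitive`, which turns the distributional equation into one between absolutely
continuous functions. The modes come from `exists_volterra_solution`, a contraction for the WKB
amplitude when |z| is large; the growing ones are reflections of decaying ones.
`indicator_elimination` and `tendsto_log_norm_div` then give the rate. -/

namespace HeatEnclosure

/-! ### Primitives of integrable functions and integration by parts -/

/-- `f` is, on `[0, L]`, a primitive of the integrable function `g`. -/
structure IsPrimitive {E : Type*} [NormedAddCommGroup E] [NormedSpace ℝ E] (L : ℝ) (f g : ℝ → E) :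
    Prop where
  integrable : IntervalIntegrable g volume 0 L
  eq : ∀ x ∈ Icc 0 L, f x = f 0 + ∫ t in (0 : ℝ)..x, g t

namespace IsPrimitive

variable {E : Type*} [NormedAddCommGroup E] [NormedSpace ℝ E] {L : ℝ}

theorem integrable_of_mem {f g : ℝ → E} (h : IsPrimitive L f g) {x : ℝ} (hx : x ∈ Icc 0 L) :
    IntervalIntegrable g volume 0 x :=
  h.integrable.mono_set (by
    rw [uIcc_of_le hx.1, uIcc_of_le (hx.1.trans hx.2)]; exact Icc_subset_Icc_right hx.2)

theorem continuousOn {f g : ℝ → E} (hL : 0 ≤ L) (h : IsPrimitive L f g) :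
    ContinuousOn f (Icc 0 L) := by
  have h1 : ContinuousOn (fun x => f 0 + ∫ t in (0 : ℝ)..x, g t) (Icc 0 L) := by
    have := intervalIntegral.continuousOn_primitive_interval' h.integrable
      (left_mem_uIcc (a := (0 : ℝ)) (b := L))
    rw [uIcc_of_le hL] at this
    exact continuousOn_const.add this
  exact h1.congr h.eq

theorem comp_clm {F : Type*} [NormedAddCommGroup F] [NormedSpace ℝ F] [CompleteSpace E]
    [CompleteSpace F] {f g : ℝ → E} (h : IsPrimitive L f g) (A : E →L[ℝ] F) :
    IsPrimitive L (fun x => A (f x)) (fun x => A (g x)) where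
  integrable := ⟨A.integrable_comp h.integrable.1, A.integrable_comp h.integrable.2⟩
  eq x hx := by
    rw [h.eq x hx, map_add, A.intervalIntegral_comp_comm (h.integrable_of_mem hx)]

theorem of_hasDerivWithinAt [CompleteSpace E] {f g : ℝ → E} (hL : 0 ≤ L)
    (h : ∀ x ∈ Icc 0 L, HasDerivWithinAt f (g x) (Icc 0 L) x) (hg : ContinuousOn g (Icc 0 L)) :
    IsPrimitive L f g where
  integrable := by
    apply ContinuousOn.intervalIntegrable
    rwa [uIcc_of_le hL]
  eq x hx := by
    have hsub : Icc 0 x ⊆ Icc 0 L := Icc_subset_Icc_right hx.2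
    rw [intervalIntegral.integral_eq_sub_of_hasDerivAt_of_le hx.1 (f := f)]
    · simp
    · exact fun y hy => ((h y (hsub hy)).continuousWithinAt).mono hsub
    · intro y hy
      exact (h y (hsub (Ioo_subset_Icc_self hy))).hasDerivAt
        (Icc_mem_nhds hy.1 (hy.2.trans_le hx.2))
    · apply ContinuousOn.intervalIntegrable
      rw [uIcc_of_le hx.1]
      exact hg.mono hsub

/-- Both functions agree on [0, L] with an integral function, which is absolutely continuous there
and has the integrand as its derivative almost everywhere. Integration by parts for absolutely
continuous functions therefore applies. -/
theorem integral_mul_real {f g φ ψ : ℝ → ℝ} (hL : 0 ≤ L) (h : IsPrimitive L f g)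
    (h' : IsPrimitive L φ ψ) :
    ∫ x in (0 : ℝ)..L, φ x * g x = φ L * f L - φ 0 * f 0 - ∫ x in (0 : ℝ)..L, ψ x * f x := by
  have key : ∀ {f g : ℝ → ℝ}, IsPrimitive L f g →
      AbsolutelyContinuousOnInterval (fun x => f 0 + ∫ t in (0 : ℝ)..x, g t) 0 L ∧
      ∀ᵐ x, x ∈ uIcc 0 L → deriv (fun x => f 0 + ∫ t in (0 : ℝ)..x, g t) x = g x := by
    intro f g h
    constructor
    · exact (contDiffOn_const (c := f 0)).absolutelyContinuousOnInterval.add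
        (h.integrable.absolutelyContinuousOnInterval_intervalIntegral left_mem_uIcc)
    · filter_upwards [h.integrable.ae_hasDerivAt_integral] with x hx hx'
      exact ((hx hx' 0 left_mem_uIcc).const_add _).deriv
  obtain ⟨ha, hd⟩ := key h
  obtain ⟨ha', hd'⟩ := key h'
  have := ha'.integral_mul_deriv_eq_deriv_mul ha
  have m0 : (0 : ℝ) ∈ Icc 0 L := left_mem_Icc.2 hL
  have mL : L ∈ Icc 0 L := right_mem_Icc.2 hL
  simp only [← h.eq 0 m0, ← h.eq L mL, ← h'.eq 0 m0, ← h'.eq L mL] at this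
  rw [← intervalIntegral.integral_congr_ae, this, ← intervalIntegral.integral_congr_ae]
  · filter_upwards [hd'] with x hx hx'
    have hx'' := uIoc_subset_uIcc hx'
    rw [hx hx'']
    rw [uIcc_of_le hL] at hx''
    rw [← h.eq x hx'']
  · filter_upwards [hd] with x hx hx'
    have hx'' := uIoc_subset_uIcc hx'
    rw [hx hx'']
    rw [uIcc_of_le hL] at hx''
    rw [← h'.eq x hx'']

theorem integral_mul {f g φ ψ : ℝ → ℂ} (hL : 0 ≤ L) (h : IsPrimitive L f g)
    (h' : IsPrimitive L φ ψ) :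
    ∫ x in (0 : ℝ)..L, φ x * g x = φ L * f L - φ 0 * f 0 - ∫ x in (0 : ℝ)..L, ψ x * f x := by
  have hr := h.comp_clm Complex.reCLM
  have hi := h.comp_clm Complex.imCLM
  have hr' := h'.comp_clm Complex.reCLM
  have hi' := h'.comp_clm Complex.imCLM
  have e1 := hr.integral_mul_real hL hr'
  have e2 := hi.integral_mul_real hL hi'
  have e3 := hr.integral_mul_real hL hi'
  have e4 := hi.integral_mul_real hL hr'
  -- A complex product consists of four real products, so the claim reduces to the four real
  -- identities `e1` to `e4`.
  have split : ∀ {u v : ℝ → ℂ}, IntervalIntegrable u volume 0 L → ContinuousOn v (Icc 0 L) →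
      (∫ x in (0 : ℝ)..L, u x * v x) =
        ((∫ x in (0 : ℝ)..L, (u x).re * (v x).re) - ∫ x in (0 : ℝ)..L, (u x).im * (v x).im : ℝ) +
        Complex.I * ((∫ x in (0 : ℝ)..L, (u x).re * (v x).im) +
          ∫ x in (0 : ℝ)..L, (u x).im * (v x).re : ℝ) := by
    intro u v hu hv
    rw [← uIcc_of_le hL] at hv
    have ur : IntervalIntegrable (fun x => (u x).re) volume 0 L :=
      ⟨Complex.reCLM.integrable_comp hu.1, Complex.reCLM.integrable_comp hu.2⟩
    have ui : IntervalIntegrable (fun x => (u x).im) volume 0 L :=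
      ⟨Complex.imCLM.integrable_comp hu.1, Complex.imCLM.integrable_comp hu.2⟩
    have vr : ContinuousOn (fun x => (v x).re) (uIcc 0 L) :=
      Complex.continuous_re.comp_continuousOn hv
    have vi : ContinuousOn (fun x => (v x).im) (uIcc 0 L) :=
      Complex.continuous_im.comp_continuousOn hv
    rw [← intervalIntegral.integral_sub (ur.mul_continuousOn vr) (ui.mul_continuousOn vi),
      ← intervalIntegral.integral_add (ur.mul_continuousOn vi) (ui.mul_continuousOn vr),
      ← intervalIntegral.integral_ofReal, ← intervalIntegral.integral_ofReal,
      ← intervalIntegral.integral_const_mul, ← intervalIntegral.integral_add]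
    · congr 1
      ext x
      apply Complex.ext <;> simp
    · have := (ur.mul_continuousOn vr).sub (ui.mul_continuousOn vi)
      exact ⟨this.1.ofReal, this.2.ofReal⟩
    · have := (ur.mul_continuousOn vi).add (ui.mul_continuousOn vr)
      exact IntervalIntegrable.const_mul ⟨this.1.ofReal, this.2.ofReal⟩ _
  rw [show (fun x => φ x * g x) = fun x => g x * φ x from funext fun x => mul_comm _ _,
    split h.integrable (h'.continuousOn hL), split h'.integrable (h.continuousOn hL)]
  simp only [Complex.reCLM_apply, Complex.imCLM_apply, mul_comm (Complex.re (φ _)),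
    mul_comm (Complex.im (φ _))] at e1 e2 e3 e4
  rw [e1, e2, e3, e4]
  apply Complex.ext <;> simp <;> ring

end IsPrimitive

/-! ### The du Bois-Reymond lemma -/

/-- The primitive of a test function of zero mean is a test function. -/
theorem exists_testFunction_deriv {L : ℝ} {ψ : ℝ → ℝ} (hψ : ContDiff ℝ ∞ ψ)
    (hc : HasCompactSupport ψ) (hs : tsupport ψ ⊆ Ioo 0 L) (h0 : ∫ x in Ioo 0 L, ψ x = 0) :
    ∃ η : ℝ → ℝ, ContDiff ℝ ∞ η ∧ HasCompactSupport η ∧ tsupport η ⊆ Ioo 0 L ∧ deriv η = ψ := by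
  rcases (tsupport ψ).eq_empty_or_nonempty with he | hne
  · have : ψ = 0 := tsupport_eq_empty_iff.1 he
    refine ⟨0, contDiff_const, HasCompactSupport.zero, ?_, ?_⟩
    · have : tsupport (0 : ℝ → ℝ) = ∅ := tsupport_eq_empty_iff.2 rfl
      rw [this]; exact empty_subset _
    · rw [this]; ext x; simp
  have hK : IsCompact (tsupport ψ) := hc
  obtain ⟨α, hα, hα'⟩ := hK.exists_isLeast hne
  obtain ⟨β, hβ, hβ'⟩ := hK.exists_isGreatest hne
  have hzl : ∀ x, x < α → ψ x = 0 := fun x hx =>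
    image_eq_zero_of_notMem_tsupport fun h => (not_lt.2 (hα' h)) hx
  have hzr : ∀ x, β < x → ψ x = 0 := fun x hx =>
    image_eq_zero_of_notMem_tsupport fun h => (not_lt.2 (hβ' h)) hx
  have hcont : Continuous ψ := hψ.continuous
  have hd : ∀ x, HasDerivAt (fun x => ∫ t in (0 : ℝ)..x, ψ t) (ψ x) x := fun x =>
    intervalIntegral.integral_hasDerivAt_right (hcont.intervalIntegrable _ _)
      hcont.aestronglyMeasurable.stronglyMeasurableAtFilter hcont.continuousAt
  have hL : (0 : ℝ) ≤ L := (hs hα).1.le.trans (hs hα).2.le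
  have hderiv : deriv (fun x => ∫ t in (0 : ℝ)..x, ψ t) = ψ := funext fun x => (hd x).deriv
  -- Left of the support the primitive has not started to grow; right of it the primitive has
  -- reached the total integral, which is zero.
  have hsub : Function.support (fun x => ∫ t in (0 : ℝ)..x, ψ t) ⊆ Icc α β := by
    intro x hx
    by_contra hcon
    apply hx
    rw [mem_Icc, not_and_or, not_le, not_le] at hcon
    rcases hcon with h | h
    · apply intervalIntegral.integral_zero_ae
      refine Eventually.of_forall fun y hy => ?_
      have hy := uIoc_subset_uIcc hy
      exact hzl y (hy.2.trans_lt (max_lt (hs hα).1 h))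
    · have h1 : ∫ t in (0 : ℝ)..L, ψ t = 0 := by
        rw [intervalIntegral.integral_of_le hL, integral_Ioc_eq_integral_Ioo, h0]
      have h2 : ∫ t in L..x, ψ t = 0 := by
        apply intervalIntegral.integral_zero_ae
        refine Eventually.of_forall fun y hy => ?_
        have hy := uIoc_subset_uIcc hy
        exact hzr y ((lt_min (hs hβ).2 h).trans_le hy.1)
      change ∫ t in (0 : ℝ)..x, ψ t = 0
      rw [← intervalIntegral.integral_add_adjacent_intervals (hcont.intervalIntegrable 0 L)
        (hcont.intervalIntegrable L x), h1, h2, add_zero]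
  have hts : tsupport (fun x => ∫ t in (0 : ℝ)..x, ψ t) ⊆ Icc α β :=
    closure_minimal hsub isClosed_Icc
  refine ⟨_, ?_, ?_, hts.trans fun x hx => ⟨(hs hα).1.trans_le hx.1, hx.2.trans_lt (hs hβ).2⟩,
    hderiv⟩
  · rw [contDiff_infty_iff_deriv, hderiv]
    exact ⟨fun x => (hd x).differentiableAt, hψ⟩
  · exact HasCompactSupport.of_support_subset_isCompact isCompact_Icc hsub

/-- A continuous function whose distributional derivative is integrable is a primitive of it. -/
theorem HasWeakDeriv.isPrimitive {L : ℝ} (hL : 0 < L) {f g : ℝ → ℝ}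
    (hf : ContinuousOn f (Icc 0 L)) (hg : IntegrableOn g (Ioo 0 L)) (h : HasWeakDeriv L f g) :
    IsPrimitive L f g := by
  have hgi : IntervalIntegrable g volume 0 L := by
    rwa [intervalIntegrable_iff_integrableOn_Ioo_of_le hL.le]
  have hFp : IsPrimitive L (fun x => ∫ t in (0 : ℝ)..x, g t) g := ⟨hgi, fun x hx => by simp⟩
  set F : ℝ → ℝ := fun x => ∫ t in (0 : ℝ)..x, g t with hF
  have hFc : ContinuousOn F (Icc 0 L) := hFp.continuousOn hL.le
  have ioo : ∀ k : ℝ → ℝ, ∫ x in Ioo 0 L, k x = ∫ x in (0 : ℝ)..L, k x := fun k => by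
    rw [intervalIntegral.integral_of_le hL.le, integral_Ioc_eq_integral_Ioo]
  have hkc : ContinuousOn (fun x => f x - F x) (Icc 0 L) := hf.sub hFc
  have int_of_cont : ∀ k : ℝ → ℝ, ContinuousOn k (Icc 0 L) → IntegrableOn k (Ioo 0 L) :=
    fun k hk => (hk.integrableOn_Icc).mono_set Ioo_subset_Icc_self
  -- f and F have the same distributional derivative, so f - F annihilates derivatives of test
  -- functions. For every ψ, the function ψ - (∫ψ)η₀ is such a derivative; hence f - F is a.e. the
  -- constant c, and everywhere on [0, L] by continuity.
  have hzero : ∀ η : ℝ → ℝ, ContDiff ℝ ∞ η → HasCompactSupport η → tsupport η ⊆ Ioo 0 L →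
      ∫ x in Ioo 0 L, (f x - F x) * deriv η x = 0 := by
    intro η hη hc hs
    have hη' : Continuous (deriv η) := hη.continuous_deriv (by simp)
    have e0 : η 0 = 0 := image_eq_zero_of_notMem_tsupport fun hh => lt_irrefl _ (hs hh).1
    have eL : η L = 0 := image_eq_zero_of_notMem_tsupport fun hh => lt_irrefl _ (hs hh).2
    have hηp : IsPrimitive L η (deriv η) := IsPrimitive.of_hasDerivWithinAt hL.le
      (fun x _ => ((hη.differentiable (by simp)) x).hasDerivAt.hasDerivWithinAt) hη'.continuousOn
    have := hFp.integral_mul_real hL.le hηp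
    rw [e0, eL] at this
    have h2 := h η hη hc hs
    simp only [sub_mul]
    rw [integral_sub (int_of_cont (fun x => f x * deriv η x) (hf.mul hη'.continuousOn))
      (int_of_cont (fun x => F x * deriv η x) (hFc.mul hη'.continuousOn)), h2, ioo, ioo]
    simp only [mul_comm (g _), mul_comm (F _)]
    linarith
  obtain ⟨η₀, hη₀, hc₀, hs₀, hi₀⟩ : ∃ η : ℝ → ℝ, ContDiff ℝ ∞ η ∧ HasCompactSupport η ∧
      tsupport η ⊆ Ioo 0 L ∧ ∫ x in Ioo 0 L, η x = 1 := by
    let b : ContDiffBump (L / 2) := ⟨L / 8, L / 4, by positivity, by linarith⟩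
    have hts : tsupport (b.normed volume) ⊆ Ioo 0 L := by
      rw [b.tsupport_normed_eq, Real.closedBall_eq_Icc]
      intro x hx
      have : b.rOut = L / 4 := rfl
      rw [this] at hx
      exact ⟨by linarith [hx.1], by linarith [hx.2]⟩
    refine ⟨b.normed volume, b.contDiff_normed, b.hasCompactSupport_normed, hts, ?_⟩
    rw [← b.integral_normed (μ := volume)]
    exact setIntegral_eq_integral_of_forall_compl_eq_zero fun x hx =>
      image_eq_zero_of_notMem_tsupport fun hh => hx (hts hh)
  set c := ∫ x in Ioo 0 L, (f x - F x) * η₀ x with hcdef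
  have hae : ∀ᵐ x, x ∈ Ioo 0 L → f x - F x - c = 0 := by
    apply isOpen_Ioo.ae_eq_zero_of_integral_contDiff_smul_eq_zero
    · exact (int_of_cont _ (hkc.sub continuousOn_const)).locallyIntegrableOn
    intro ψ hψ hψc hψs
    set m := ∫ x in Ioo 0 L, ψ x with hm
    have h1 : IntegrableOn ψ (Ioo 0 L) := int_of_cont _ hψ.continuous.continuousOn
    have h2 : IntegrableOn η₀ (Ioo 0 L) := int_of_cont _ hη₀.continuous.continuousOn
    have hsupp : tsupport (fun x => ψ x - m * η₀ x) ⊆ tsupport ψ ∪ tsupport η₀ := by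
      apply closure_minimal _ ((isClosed_tsupport _).union (isClosed_tsupport _))
      intro x hx
      by_contra hcon
      rw [mem_union, not_or] at hcon
      apply hx
      simp [image_eq_zero_of_notMem_tsupport hcon.1, image_eq_zero_of_notMem_tsupport hcon.2]
    obtain ⟨η, a1, a2, a3, a4⟩ := exists_testFunction_deriv (L := L)
      (ψ := fun x => ψ x - m * η₀ x) (hψ.sub (contDiff_const.mul hη₀))
      ((hψc.isCompact.union hc₀.isCompact).of_isClosed_subset (isClosed_tsupport _) hsupp)
      (hsupp.trans (union_subset hψs hs₀)) (by
        rw [integral_sub h1 (h2.const_mul m), integral_const_mul, hi₀]; simp [hm])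
    have h3 := hzero η a1 a2 a3
    rw [a4] at h3
    have h4 : IntegrableOn (fun x => (f x - F x) * ψ x) (Ioo 0 L) :=
      int_of_cont _ (hkc.mul hψ.continuous.continuousOn)
    have h5 : IntegrableOn (fun x => (f x - F x) * η₀ x) (Ioo 0 L) :=
      int_of_cont _ (hkc.mul hη₀.continuous.continuousOn)
    have h6 : ∫ x in Ioo 0 L, (f x - F x) * (ψ x - m * η₀ x) =
        (∫ x in Ioo 0 L, (f x - F x) * ψ x) - m * c := by
      rw [hcdef, ← integral_const_mul, ← integral_sub h4 (h5.const_mul m)]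
      congr 1; ext x; ring
    rw [← setIntegral_eq_integral_of_forall_compl_eq_zero (s := Ioo 0 L) fun x hx => by
      rw [image_eq_zero_of_notMem_tsupport fun hh => hx (hψs hh), zero_smul]]
    have h7 : ∫ x in Ioo 0 L, ψ x • (f x - F x - c) =
        (∫ x in Ioo 0 L, (f x - F x) * ψ x) - c * m := by
      rw [hm, ← integral_const_mul, ← integral_sub h4 (h1.const_mul c)]
      congr 1; ext x; simp only [smul_eq_mul]; ring
    rw [h7]
    linarith [h6 ▸ h3]
  have hconst : EqOn (fun x => f x - F x) (fun _ => c) (Icc 0 L) := by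
    refine Measure.eqOn_Icc_of_ae_eq (μ := volume) hL.ne ?_ hkc continuousOn_const
    rw [EventuallyEq, ← restrict_Ioo_eq_restrict_Icc, ae_restrict_iff' measurableSet_Ioo]
    filter_upwards [hae] with x hx hx'
    linarith [hx hx']
  refine ⟨hgi, fun x hx => ?_⟩
  have e1 := hconst hx
  have e2 := hconst (left_mem_Icc.2 hL.le)
  simp only [hF, intervalIntegral.integral_same] at e1 e2
  linarith

namespace IsPrimitive

variable {E : Type*} [NormedAddCommGroup E] [NormedSpace ℝ E] {L : ℝ}

theorem add {f g φ ψ : ℝ → E} (h : IsPrimitive L f g) (h' : IsPrimitive L φ ψ) :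
    IsPrimitive L (fun x => f x + φ x) (fun x => g x + ψ x) where
  integrable := h.integrable.add h'.integrable
  eq x hx := by
    rw [h.eq x hx, h'.eq x hx,
      intervalIntegral.integral_add (h.integrable_of_mem hx) (h'.integrable_of_mem hx)]
    abel

theorem congr {f g φ ψ : ℝ → E} (hL : 0 ≤ L) (h : IsPrimitive L f g)
    (hf : ∀ x ∈ Icc 0 L, φ x = f x) (hg : ∀ᵐ x ∂(volume.restrict (Ioo 0 L)), ψ x = g x) :
    IsPrimitive L φ ψ where
  integrable := by
    rw [intervalIntegrable_iff_integrableOn_Ioo_of_le hL]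
    have := h.integrable
    rw [intervalIntegrable_iff_integrableOn_Ioo_of_le hL] at this
    exact this.congr (hg.mono fun x hx => hx.symm)
  eq x hx := by
    rw [hf x hx, hf 0 (left_mem_Icc.2 hL), h.eq x hx]
    congr 1
    rw [intervalIntegral.integral_of_le hx.1, intervalIntegral.integral_of_le hx.1,
      integral_Ioc_eq_integral_Ioo, integral_Ioc_eq_integral_Ioo]
    apply integral_congr_ae
    exact (ae_restrict_of_ae_restrict_of_subset (Ioo_subset_Ioo_right hx.2) hg).mono
      fun x hx => hx.symm

end IsPrimitive

/-! ### Pairings and traces of a weak solution -/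

theorem setIntegral_Ioo_eq {E : Type*} [NormedAddCommGroup E] [NormedSpace ℝ E] {L : ℝ}
    (hL : 0 ≤ L) (k : ℝ → E) : ∫ x in Ioo 0 L, k x = ∫ x in (0 : ℝ)..L, k x := by
  rw [intervalIntegral.integral_of_le hL, integral_Ioc_eq_integral_Ioo]

theorem memLp_of_continuousOn {E : Type*} [NormedAddCommGroup E] {L : ℝ} {f : ℝ → E}
    (hf : ContinuousOn f (Icc 0 L)) (q : ENNReal) : MemLp f q (volume.restrict (Ioo 0 L)) := by
  obtain ⟨C, hC⟩ := isCompact_Icc.exists_bound_of_continuousOn hf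
  refine MemLp.of_bound ?_ C ?_
  · exact (hf.mono Ioo_subset_Icc_self).aestronglyMeasurable measurableSet_Ioo
  · exact (ae_restrict_iff' measurableSet_Ioo).2
      (Eventually.of_forall fun x hx => hC x (Ioo_subset_Icc_self hx))

theorem integrableOn_of_memLp_two {f : ℝ → ℝ} {L : ℝ}
    (h : MemLp f 2 (volume.restrict (Ioo 0 L))) : IntegrableOn f (Ioo 0 L) :=
  h.integrable (by norm_num)

theorem integrableOn_mul_of_continuousOn {f : ℝ → ℝ} {w : ℝ → ℂ} {L : ℝ}
    (hf : MemLp f 2 (volume.restrict (Ioo 0 L))) (hw : ContinuousOn w (Icc 0 L)) :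
    IntegrableOn (fun x => (f x : ℂ) * w x) (Ioo 0 L) :=
  MemLp.integrable_mul (p := 2) (q := 2) hf.ofReal (memLp_of_continuousOn hw 2)

theorem IsH1.of_hasDerivWithinAt {a : ℝ} (ha : 0 ≤ a) {f g : ℝ → ℝ}
    (h : ∀ x ∈ Icc 0 a, HasDerivWithinAt f (g x) (Icc 0 a) x) (hg : ContinuousOn g (Icc 0 a)) :
    IsH1 a f g where
  continuousOn x hx := (h x hx).continuousWithinAt
  memLp := memLp_of_continuousOn (fun x hx => (h x hx).continuousWithinAt) 2
  memLp_deriv := memLp_of_continuousOn hg 2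
  weakDeriv η hη hc hs := by
    have e0 : η 0 = 0 := image_eq_zero_of_notMem_tsupport fun hh => lt_irrefl _ (hs hh).1
    have eL : η a = 0 := image_eq_zero_of_notMem_tsupport fun hh => lt_irrefl _ (hs hh).2
    have hη' : IsPrimitive a η (deriv η) := IsPrimitive.of_hasDerivWithinAt ha
      (fun x _ => ((hη.differentiable (by simp)) x).hasDerivAt.hasDerivWithinAt)
      (hη.continuous_deriv (by simp)).continuousOn
    have := hη'.integral_mul_real ha (IsPrimitive.of_hasDerivWithinAt ha h hg)
    rw [setIntegral_Ioo_eq ha, setIntegral_Ioo_eq ha, this, e0, eL]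
    ring

theorem IsH1.isPrimitive {a : ℝ} (ha : 0 < a) {f g : ℝ → ℝ} (h : IsH1 a f g) :
    IsPrimitive a f g :=
  h.weakDeriv.isPrimitive ha h.continuousOn (integrableOn_of_memLp_two h.memLp_deriv)

namespace IsSolution

variable {γ : ℝ → ℝ} {ρ a T : ℝ} {u ux : ℝ → ℝ → ℝ} {f₀ f₁ : ℝ → ℝ}

theorem prod_integrable {w : ℝ → ℝ → ℝ} {φ : ℝ → ℝ}
    (hw : MemLp (fun p : ℝ × ℝ => w p.1 p.2) 2 (volume.restrict (Ioo 0 a ×ˢ Ioo 0 T)))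
    (hφ : ContinuousOn φ (Icc 0 a)) :
    Integrable (fun p : ℝ × ℝ => φ p.1 * w p.1 p.2)
      ((volume.restrict (Ioo 0 a)).prod (volume.restrict (Ioo 0 T))) := by
  rw [Measure.volume_eq_prod, ← Measure.prod_restrict] at hw
  obtain ⟨C, hC⟩ := isCompact_Icc.exists_bound_of_continuousOn hφ
  have hw1 := hw.integrable (by norm_num)
  refine hw1.bdd_mul (c := C) ?_ ?_
  · exact ((hφ.mono Ioo_subset_Icc_self).aestronglyMeasurable measurableSet_Ioo).comp_fst
  · have : ∀ᵐ x ∂(volume.restrict (Ioo 0 a)), ‖φ x‖ ≤ C :=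
      (ae_restrict_iff' measurableSet_Ioo).2
        (Eventually.of_forall fun x hx => hC x (Ioo_subset_Icc_self hx))
    exact Measure.quasiMeasurePreserving_fst.ae this

theorem integrable_pairing {w : ℝ → ℝ → ℝ} {φ : ℝ → ℝ}
    (hw : MemLp (fun p : ℝ × ℝ => w p.1 p.2) 2 (volume.restrict (Ioo 0 a ×ˢ Ioo 0 T)))
    (hφ : ContinuousOn φ (Icc 0 a)) :
    IntegrableOn (fun t => ∫ x in Ioo 0 a, φ x * w x t) (Ioo 0 T) :=
  (prod_integrable hw hφ).integral_prod_right

/-- Continuity of u into L², combined with Hölder's inequality. It is what allows the du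
Bois-Reymond lemma to hold at every time, including t = 0 and t = T. -/
theorem continuousOn_pairing (hs : IsSolution γ ρ a T u ux f₀ f₁) {φ : ℝ → ℝ}
    (hφ : MemLp φ 2 (volume.restrict (Ioo 0 a))) :
    ContinuousOn (fun t => ∫ x in Ioo 0 a, u x t * φ x) (Icc 0 T) := by
  intro s hsT
  have hint : ∀ t ∈ Icc 0 T, IntegrableOn (fun x => u x t * φ x) (Ioo 0 a) := fun t ht =>
    MemLp.integrable_mul (p := 2) (q := 2) (hs.memLp_slice t ht) hφ
  rw [ContinuousWithinAt, tendsto_iff_norm_sub_tendsto_zero]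
  have hlim : Tendsto (fun t => (eLpNorm (fun x => u x t - u x s) 2 (volume.restrict (Ioo 0 a)) *
      eLpNorm φ 2 (volume.restrict (Ioo 0 a))).toReal) (𝓝[Icc 0 T] s) (𝓝 0) := by
    have h1 := ENNReal.Tendsto.mul_const (hs.continuous_slice s hsT)
      (b := eLpNorm φ 2 (volume.restrict (Ioo 0 a))) (Or.inr hφ.eLpNorm_ne_top)
    rw [zero_mul] at h1
    exact (ENNReal.tendsto_toReal ENNReal.zero_ne_top).comp h1
  refine squeeze_zero' (Eventually.of_forall fun t => norm_nonneg _) ?_ hlim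
  filter_upwards [self_mem_nhdsWithin] with t ht
  have hd : MemLp (fun x => u x t - u x s) 2 (volume.restrict (Ioo 0 a)) :=
    (hs.memLp_slice t ht).sub (hs.memLp_slice s hsT)
  have e : (∫ x in Ioo 0 a, u x t * φ x) - ∫ x in Ioo 0 a, u x s * φ x =
      ∫ x in Ioo 0 a, (u x t - u x s) * φ x := by
    rw [← integral_sub (hint t ht) (hint s hsT)]
    congr 1; ext x; ring
  rw [e, ← toReal_enorm]
  refine ENNReal.toReal_mono (ENNReal.mul_ne_top hd.eLpNorm_ne_top hφ.eLpNorm_ne_top) ?_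
  refine (enorm_integral_le_lintegral_enorm _).trans ?_
  rw [← eLpNorm_one_eq_lintegral_enorm]
  exact eLpNorm_smul_le_mul_eLpNorm (p := 2) (q := 2) (r := 1) (f := φ)
    (φ := fun x => u x t - u x s) hφ.1 hd.1

theorem isPrimitive_pairing_real (hs : IsSolution γ ρ a T u ux f₀ f₁) (ha : 0 < a) (hT : 0 < T)
    (hγ : ContinuousOn γ (Icc 0 a)) {φ φ' : ℝ → ℝ}
    (hφ : ∀ x ∈ Icc 0 a, HasDerivWithinAt φ (φ' x) (Icc 0 a) x)
    (hφ' : ContinuousOn φ' (Icc 0 a)) :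
    IsPrimitive T (fun t => ∫ x in Ioo 0 a, u x t * φ x)
      (fun t => γ a * f₁ t * φ a - γ 0 * f₀ t * φ 0 -
        ∫ x in Ioo 0 a, γ x * ux x t * φ' x) := by
  have h1 := IsH1.of_hasDerivWithinAt ha.le hφ hφ'
  refine (hs.equation φ φ' h1).isPrimitive hT (hs.continuousOn_pairing h1.memLp) ?_
  have i1 := ((integrableOn_of_memLp_two hs.memLp_flux_end).const_mul (γ a)).mul_const (φ a)
  have i0 := ((integrableOn_of_memLp_two hs.memLp_flux_zero).const_mul (γ 0)).mul_const (φ 0)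
  refine (i1.sub i0).sub ?_
  have := integrable_pairing hs.memLp_deriv (hγ.mul hφ')
  refine this.congr (Eventually.of_forall fun t => ?_)
  simp only [Pi.mul_apply]
  congr 1; ext x; ring

theorem pairing_initial (hs : IsSolution γ ρ a T u ux f₀ f₁) (φ : ℝ → ℂ) :
    ∫ x in Ioo 0 a, (u x 0 : ℂ) * φ x = 0 := by
  rw [← integral_zero ℝ ℂ (μ := volume.restrict (Ioo 0 a))]
  apply integral_congr_ae
  filter_upwards [hs.initial] with x hx
  simp [hx]

theorem isPrimitive_pairing (hs : IsSolution γ ρ a T u ux f₀ f₁) (ha : 0 < a) (hT : 0 < T)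
    (hγ : ContinuousOn γ (Icc 0 a)) {φ φ' : ℝ → ℂ}
    (hφ : ∀ x ∈ Icc 0 a, HasDerivWithinAt φ (φ' x) (Icc 0 a) x)
    (hφ' : ContinuousOn φ' (Icc 0 a)) :
    IsPrimitive T (fun t => ∫ x in Ioo 0 a, (u x t : ℂ) * φ x)
      (fun t => γ a * f₁ t * φ a - γ 0 * f₀ t * φ 0 -
        ∫ x in Ioo 0 a, (ux x t : ℂ) * (γ x * φ' x)) := by
  have hφc : ContinuousOn φ (Icc 0 a) := fun x hx => (hφ x hx).continuousWithinAt
  have hr := hs.isPrimitive_pairing_real ha hT hγ (φ := fun x => (φ x).re)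
    (φ' := fun x => (φ' x).re) (fun x hx => Complex.reCLM.hasFDerivAt.comp_hasDerivWithinAt x (hφ x hx))
    (Complex.continuous_re.comp_continuousOn hφ')
  have hi := hs.isPrimitive_pairing_real ha hT hγ (φ := fun x => (φ x).im)
    (φ' := fun x => (φ' x).im) (fun x hx => Complex.imCLM.hasFDerivAt.comp_hasDerivWithinAt x (hφ x hx))
    (Complex.continuous_im.comp_continuousOn hφ')
  have hsum := (hr.comp_clm Complex.ofRealCLM).add
    (hi.comp_clm (Complex.I • Complex.ofRealCLM))
  have hγc : ContinuousOn (fun x => (γ x : ℂ) * φ' x) (Icc 0 a) :=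
    (Complex.continuous_ofReal.comp_continuousOn hγ).mul hφ'
  refine hsum.congr hT.le ?_ ?_
  · intro t ht
    have hint := integrableOn_mul_of_continuousOn (hs.memLp_slice t ht) hφc
    rw [← integral_re_add_im hint]
    simp [mul_comm]
  · filter_upwards [hs.isH1] with t ht
    have hint := integrableOn_mul_of_continuousOn ht.memLp_deriv hγc
    rw [← integral_re_add_im hint]
    apply Complex.ext <;>
    · simp
      congr 1; ext x; ring

/-- Integrating by parts in x removes u_x from the pairing at the price of the two traces. With p
the flux of a mode, p' = z²y brings back the pairing of u with y. -/
theorem ae_traces (hs : IsSolution γ ρ a T u ux f₀ f₁) (ha : 0 < a) {p p' : ℝ → ℂ}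
    (hp : ∀ x ∈ Icc 0 a, HasDerivWithinAt p (p' x) (Icc 0 a) x)
    (hp' : ContinuousOn p' (Icc 0 a)) :
    ∀ᵐ t ∂(volume.restrict (Ioo 0 T)), ∫ x in Ioo 0 a, (ux x t : ℂ) * p x =
      p a * u a t - p 0 * u 0 t - ∫ x in Ioo 0 a, (u x t : ℂ) * p' x := by
  filter_upwards [hs.isH1] with t ht
  have h1 := (ht.isPrimitive ha).comp_clm Complex.ofRealCLM
  have := h1.integral_mul ha.le (IsPrimitive.of_hasDerivWithinAt ha.le hp hp')
  simp only [Complex.ofRealCLM_apply] at this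
  rw [setIntegral_Ioo_eq ha.le, setIntegral_Ioo_eq ha.le]
  simp only [mul_comm (Complex.ofReal (u _ t)), mul_comm (Complex.ofReal (ux _ t))]
  rw [this]

/-- A trace is a combination of space integrals of u and u_x, whose measurability and integrability
in t follow from Fubini. Testing with x - (a - k) produces k u(a,t) + (a - k)u(0,t), and k = 0 or k
= a isolates one endpoint. -/
theorem integrable_trace (hs : IsSolution γ ρ a T u ux f₀ f₁) (ha : 0 < a) (b : ℝ)
    (hb : b = 0 ∨ b = a) : IntegrableOn (fun t => u b t) (Ioo 0 T) := by
  have key : ∀ k : ℝ, IntegrableOn (fun t => k * (u a t) + (a - k) * u 0 t) (Ioo 0 T) := by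
    intro k
    have i1 := integrable_pairing hs.memLp_deriv (φ := fun x => x - (a - k)) (by fun_prop)
    have i2 := integrable_pairing hs.memLp (φ := fun _ => (1 : ℝ)) (by fun_prop)
    refine (i1.add i2).congr ?_
    filter_upwards [hs.isH1] with t ht
    have hp : IsPrimitive a (fun x => x - (a - k)) (fun _ => (1 : ℝ)) :=
      IsPrimitive.of_hasDerivWithinAt ha.le
        (fun x _ => ((hasDerivAt_id x).sub_const _).hasDerivWithinAt) (by fun_prop)
    have := (ht.isPrimitive ha).integral_mul_real ha.le hp
    simp only [Pi.add_apply]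
    rw [setIntegral_Ioo_eq ha.le, setIntegral_Ioo_eq ha.le, this]
    ring
  rcases hb with rfl | rfl
  · have := (key 0).const_mul a⁻¹
    refine this.congr (Eventually.of_forall fun t => ?_)
    simp only
    field_simp
    ring
  · have := (key b).const_mul b⁻¹
    refine this.congr (Eventually.of_forall fun t => ?_)
    simp only
    field_simp
    ring

end IsSolution

/-! ### Modes and the Laplace transformed Green identity -/

/-- `y` solves `(γ y')' = z² y` on `[0, L]`, and `p = γ y'` is its flux. -/
structure IsMode (γ : ℝ → ℝ) (L : ℝ) (z : ℂ) (y p : ℝ → ℂ) : Prop where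
  deriv : ∀ x ∈ Icc 0 L, HasDerivWithinAt y (p x / γ x) (Icc 0 L) x
  deriv_flux : ∀ x ∈ Icc 0 L, HasDerivWithinAt p (z ^ 2 * y x) (Icc 0 L) x

namespace IsMode

variable {γ : ℝ → ℝ} {L : ℝ} {z : ℂ} {y p : ℝ → ℂ}

theorem continuousOn (h : IsMode γ L z y p) : ContinuousOn y (Icc 0 L) :=
  fun x hx => (h.deriv x hx).continuousWithinAt

theorem continuousOn_flux (h : IsMode γ L z y p) : ContinuousOn p (Icc 0 L) :=
  fun x hx => (h.deriv_flux x hx).continuousWithinAt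

theorem mono (h : IsMode γ L z y p) {a : ℝ} (ha : a ≤ L) : IsMode γ a z y p where
  deriv x hx := (h.deriv x (Icc_subset_Icc_right ha hx)).mono (Icc_subset_Icc_right ha)
  deriv_flux x hx := (h.deriv_flux x (Icc_subset_Icc_right ha hx)).mono (Icc_subset_Icc_right ha)

end IsMode

theorem integrable_exp_mul {T : ℝ} {z : ℂ} {f : ℝ → ℝ} (hT : 0 ≤ T)
    (hf : IntegrableOn f (Ioo 0 T)) :
    IntervalIntegrable (fun t => Complex.exp (-z ^ 2 * t) * (f t : ℂ)) volume 0 T := by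
  have h1 : IntervalIntegrable (fun t => (f t : ℂ)) volume 0 T := by
    rw [intervalIntegrable_iff_integrableOn_Ioo_of_le hT]
    exact hf.ofReal
  exact h1.continuousOn_mul (by fun_prop)

/-- The Laplace transformed Green identity of a solution with a mode of the elliptic operator. -/
theorem IsSolution.laplace_identity {γ : ℝ → ℝ} {ρ a T : ℝ} {u ux : ℝ → ℝ → ℝ} {f₀ f₁ : ℝ → ℝ}
    (hs : IsSolution γ ρ a T u ux f₀ f₁) (ha : 0 < a) (hT : 0 < T)
    (hγ : ContinuousOn γ (Icc 0 a)) (hγpos : ∀ x ∈ Icc 0 a, 0 < γ x) {z : ℂ} {y p : ℝ → ℂ}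
    (hy : IsMode γ a z y p) :
    Complex.exp (-z ^ 2 * T) * ∫ x in Ioo 0 a, (u x T : ℂ) * y x =
      -(p a + ρ * y a) * (∫ t in (0 : ℝ)..T, Complex.exp (-z ^ 2 * t) * (u a t : ℂ))
      - γ 0 * y 0 * (∫ t in (0 : ℝ)..T, Complex.exp (-z ^ 2 * t) * (f₀ t : ℂ))
      + p 0 * ∫ t in (0 : ℝ)..T, Complex.exp (-z ^ 2 * t) * (u 0 t : ℂ) := by
  have hγ' : ∀ x ∈ Icc 0 a, (γ x : ℂ) ≠ 0 := fun x hx =>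
    Complex.ofReal_ne_zero.2 (hγpos x hx).ne'
  have hy'c : ContinuousOn (fun x => p x / (γ x : ℂ)) (Icc 0 a) :=
    hy.continuousOn_flux.div (Complex.continuous_ofReal.comp_continuousOn hγ) hγ'
  have hprim := hs.isPrimitive_pairing ha hT hγ hy.deriv hy'c
  -- The second integration by parts in x and the Robin condition leave only traces and z² times the
  -- pairing itself.
  have hprim' : IsPrimitive T (fun t => ∫ x in Ioo 0 a, (u x t : ℂ) * y x)
      (fun t => -(p a + ρ * y a) * (u a t : ℂ) - γ 0 * y 0 * (f₀ t : ℂ) + p 0 * (u 0 t : ℂ)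
        + z ^ 2 * ∫ x in Ioo 0 a, (u x t : ℂ) * y x) := by
    refine hprim.congr hT.le (fun _ _ => rfl) ?_
    filter_upwards [hs.ae_traces ha hy.deriv_flux (continuousOn_const.mul hy.continuousOn),
      hs.robin] with t ht hr
    have e1 : ∫ x in Ioo 0 a, (ux x t : ℂ) * (γ x * (p x / γ x)) =
        ∫ x in Ioo 0 a, (ux x t : ℂ) * p x := by
      apply setIntegral_congr_fun measurableSet_Ioo
      intro x hx
      simp only
      rw [mul_div_cancel₀ _ (hγ' x (Ioo_subset_Icc_self hx))]
    have e2 : ∫ x in Ioo 0 a, (u x t : ℂ) * (z ^ 2 * y x) =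
        z ^ 2 * ∫ x in Ioo 0 a, (u x t : ℂ) * y x := by
      rw [← integral_const_mul]
      congr 1; ext x; ring
    have e3 : (γ a : ℂ) * f₁ t = -(ρ * u a t) := by
      rw [eq_neg_iff_add_eq_zero]; exact_mod_cast hr
    rw [e1, ht, e2, e3]
    ring
  have hexp : IsPrimitive T (fun t : ℝ => Complex.exp (-z ^ 2 * t))
      (fun t : ℝ => -z ^ 2 * Complex.exp (-z ^ 2 * t)) := by
    refine IsPrimitive.of_hasDerivWithinAt hT.le (fun t _ => ?_) (by fun_prop)
    have h1 : HasDerivAt (fun w : ℂ => Complex.exp (-z ^ 2 * w))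
        (Complex.exp (-z ^ 2 * t) * (-z ^ 2 * 1)) t :=
      ((hasDerivAt_id (t : ℂ)).const_mul (-z ^ 2)).cexp
    have h2 := h1.comp_ofReal
    refine (h2.congr_deriv ?_).hasDerivWithinAt
    ring
  have key := hprim'.integral_mul hT.le hexp
  have hG : IntervalIntegrable (fun t : ℝ => Complex.exp (-z ^ 2 * t) *
      ∫ x in Ioo 0 a, (u x t : ℂ) * y x) volume 0 T := by
    apply ContinuousOn.intervalIntegrable
    rw [uIcc_of_le hT.le]
    exact ContinuousOn.mul (by fun_prop) (hprim.continuousOn hT.le)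
  have ia := integrable_exp_mul (z := z) hT.le (hs.integrable_trace ha a (Or.inr rfl))
  have i0 := integrable_exp_mul (z := z) hT.le (hs.integrable_trace ha 0 (Or.inl rfl))
  have if0 := integrable_exp_mul (z := z) hT.le (integrableOn_of_memLp_two hs.memLp_flux_zero)
  have esplit : ∫ t in (0 : ℝ)..T, Complex.exp (-z ^ 2 * t) * (-(p a + ρ * y a) * (u a t : ℂ)
        - γ 0 * y 0 * (f₀ t : ℂ) + p 0 * (u 0 t : ℂ)
        + z ^ 2 * ∫ x in Ioo 0 a, (u x t : ℂ) * y x) =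
      -(p a + ρ * y a) * (∫ t in (0 : ℝ)..T, Complex.exp (-z ^ 2 * t) * (u a t : ℂ))
      - γ 0 * y 0 * (∫ t in (0 : ℝ)..T, Complex.exp (-z ^ 2 * t) * (f₀ t : ℂ))
      + p 0 * (∫ t in (0 : ℝ)..T, Complex.exp (-z ^ 2 * t) * (u 0 t : ℂ))
      + z ^ 2 * ∫ t in (0 : ℝ)..T, Complex.exp (-z ^ 2 * t) *
        ∫ x in Ioo 0 a, (u x t : ℂ) * y x := by
    rw [← intervalIntegral.integral_const_mul, ← intervalIntegral.integral_const_mul,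
      ← intervalIntegral.integral_const_mul, ← intervalIntegral.integral_const_mul,
      ← intervalIntegral.integral_sub (ia.const_mul _) (if0.const_mul _),
      ← intervalIntegral.integral_add ((ia.const_mul _).sub (if0.const_mul _)) (i0.const_mul _),
      ← intervalIntegral.integral_add
        (((ia.const_mul _).sub (if0.const_mul _)).add (i0.const_mul _)) (hG.const_mul _)]
    congr 1; ext t; ring
  have e4 : ∫ t in (0 : ℝ)..T, -z ^ 2 * Complex.exp (-z ^ 2 * t) *
      (∫ x in Ioo 0 a, (u x t : ℂ) * y x) = -z ^ 2 * ∫ t in (0 : ℝ)..T,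
        Complex.exp (-z ^ 2 * t) * ∫ x in Ioo 0 a, (u x t : ℂ) * y x := by
    rw [← intervalIntegral.integral_const_mul]
    congr 1; ext t; ring
  -- The initial condition removes the endpoint term at t = 0; the term z² times the pairing is
  -- cancelled by the derivative of e^{-z²t}.
  rw [esplit, e4, hs.pairing_initial, mul_zero, sub_zero] at key
  linear_combination -key

/-! ### The Volterra equation for the WKB amplitude -/

theorem intervalIntegrable_of_continuousOn_Icc {E : Type*} [NormedAddCommGroup E] {M : ℝ} {k : ℝ → E} (hk : ContinuousOn k (Icc 0 M))
    {x y : ℝ} (hx : x ∈ Icc 0 M) (hy : y ∈ Icc 0 M) : IntervalIntegrable k volume x y :=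
  (hk.mono (ordConnected_Icc.uIcc_subset hx hy)).intervalIntegrable

theorem hasDerivWithinAt_integral_Icc {E : Type*} [NormedAddCommGroup E] [NormedSpace ℝ E]
    [CompleteSpace E] {M : ℝ} {k : ℝ → E}
    (hk : ContinuousOn k (Icc 0 M)) {b x : ℝ} (hb : b ∈ Icc 0 M) (hx : x ∈ Icc 0 M) :
    HasDerivWithinAt (fun x => ∫ t in b..x, k t) (k x) (Icc 0 M) x := by
  have hM : 0 ≤ M := hb.1.trans hb.2
  -- Constant extension beyond the endpoints makes the integrand continuous on the line, so the
  -- two-sided fundamental theorem applies even at 0 and M.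
  set K : ℝ → E := IccExtend hM ((Icc 0 M).domRestrict k) with hK
  have hKc : Continuous K := (continuousOn_iff_continuous_domRestrict.1 hk).Icc_extend'
  have hKe : ∀ y ∈ Icc 0 M, K y = k y := fun y hy => by
    rw [hK, IccExtend_of_mem _ _ hy]; rfl
  have h1 : HasDerivAt (fun x => ∫ t in b..x, K t) (K x) x :=
    intervalIntegral.integral_hasDerivAt_right (hKc.intervalIntegrable _ _)
      hKc.aestronglyMeasurable.stronglyMeasurableAtFilter hKc.continuousAt
  rw [hKe x hx] at h1
  refine h1.hasDerivWithinAt.congr_of_mem (fun y hy => ?_) hx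
  refine intervalIntegral.integral_congr fun t ht => ?_
  exact (hKe t (ordConnected_Icc.uIcc_subset hb hy ht)).symm

section Volterra

/-- The amplitude correction `m(x) = ∫ₓᴹ e^{2z(θ(σ) - θ(x))} g(σ) h(σ) dσ`. -/
noncomputable def fluxCorrection (M : ℝ) (θ g : ℝ → ℝ) (z : ℂ) (h : ℝ → ℂ) (x : ℝ) : ℂ :=
  -(Complex.exp (-(2 * z * θ x)) * ∫ σ in M..x, Complex.exp (2 * z * θ σ) * (g σ * h σ))

/-- The Volterra operator of the WKB correction. -/
noncomputable def volterraOp (M : ℝ) (θ g : ℝ → ℝ) (z : ℂ) (h : ℝ → ℂ) (x : ℝ) : ℂ :=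
  -(fluxCorrection M θ g z h x + ∫ σ in M..x, (g σ * h σ : ℂ)) / (2 * z)

variable {M : ℝ} {θ θ' g : ℝ → ℝ} {z : ℂ} {h : ℝ → ℂ}

theorem fluxCorrection_hasDerivWithinAt (hM : 0 ≤ M)
    (hθ : ∀ x ∈ Icc 0 M, HasDerivWithinAt θ (θ' x) (Icc 0 M) x) (hg : ContinuousOn g (Icc 0 M))
    (hh : ContinuousOn h (Icc 0 M)) {x : ℝ} (hx : x ∈ Icc 0 M) :
    HasDerivWithinAt (fluxCorrection M θ g z h)
      (-(2 * z * θ' x * fluxCorrection M θ g z h x) - g x * h x) (Icc 0 M) x := by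
  have hθc : ContinuousOn θ (Icc 0 M) := fun x hx => (hθ x hx).continuousWithinAt
  have hk : ContinuousOn (fun σ => Complex.exp (2 * z * θ σ) * (g σ * h σ)) (Icc 0 M) := by
    have h1 := Complex.continuous_ofReal.comp_continuousOn hθc
    have h2 := Complex.continuous_ofReal.comp_continuousOn hg
    exact (Complex.continuous_exp.comp_continuousOn (continuousOn_const.mul h1)).mul (h2.mul hh)
  have h1 := hasDerivWithinAt_integral_Icc hk (right_mem_Icc.2 hM) hx
  have h2 : HasDerivWithinAt (fun x => Complex.exp (-(2 * z * θ x)))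
      (Complex.exp (-(2 * z * θ x)) * (-(2 * z * θ' x))) (Icc 0 M) x :=
    (((hθ x hx).ofReal_comp).const_mul (2 * z)).neg.cexp
  refine (h2.mul h1).neg.congr_deriv ?_
  have e : Complex.exp (-(2 * z * θ x)) * Complex.exp (2 * z * θ x) = 1 := by
    rw [← Complex.exp_add]; simp
  rw [fluxCorrection]
  linear_combination (-(g x * h x : ℂ)) * e

/-- The explicit formula is ∫θ'm with m the flux correction, the double integral having been carried
out: in m' = -2zθ'm - gh the term gh cancels against the second integral. -/
theorem volterraOp_hasDerivWithinAt (hM : 0 ≤ M) (hz : z ≠ 0)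
    (hθ : ∀ x ∈ Icc 0 M, HasDerivWithinAt θ (θ' x) (Icc 0 M) x) (hg : ContinuousOn g (Icc 0 M))
    (hh : ContinuousOn h (Icc 0 M)) {x : ℝ} (hx : x ∈ Icc 0 M) :
    HasDerivWithinAt (volterraOp M θ g z h) (θ' x * fluxCorrection M θ g z h x) (Icc 0 M) x := by
  have hk : ContinuousOn (fun σ => (g σ * h σ : ℂ)) (Icc 0 M) :=
    (Complex.continuous_ofReal.comp_continuousOn hg).mul hh
  have h1 := hasDerivWithinAt_integral_Icc hk (right_mem_Icc.2 hM) hx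
  have h2 := (((fluxCorrection_hasDerivWithinAt (z := z) hM hθ hg hh hx).add h1).neg).div_const
    (2 * z)
  refine h2.congr_deriv ?_
  field_simp
  ring

/-- Integrating from M backwards keeps σ ≥ x, so for Re z ≤ 0 and θ increasing the kernel e^{2z(θ(σ)
- θ(x))} has modulus at most 1, uniformly in z. -/
theorem norm_fluxCorrection_le {G B : ℝ} (hz : z.re ≤ 0) (hθm : MonotoneOn θ (Icc 0 M))
    (hgG : ∀ x ∈ Icc 0 M, |g x| ≤ G) (hB : ∀ x ∈ Icc 0 M, ‖h x‖ ≤ B) {x : ℝ}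
    (hx : x ∈ Icc 0 M) :
    ‖fluxCorrection M θ g z h x‖ ≤ G * M * B ∧ ‖∫ σ in M..x, (g σ * h σ : ℂ)‖ ≤ G * M * B := by
  have hM : 0 ≤ M := hx.1.trans hx.2
  have hG0 : 0 ≤ G := (abs_nonneg _).trans (hgG x hx)
  have hB0 : 0 ≤ B := (norm_nonneg _).trans (hB x hx)
  have hfin : G * B * |x - M| ≤ G * M * B := by
    have : |x - M| ≤ M := by rw [abs_le]; constructor <;> linarith [hx.1, hx.2]
    calc G * B * |x - M| ≤ G * B * M := by gcongr
      _ = G * M * B := by ring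
  have hmem : ∀ σ ∈ uIoc M x, σ ∈ Icc 0 M ∧ x ≤ σ := fun σ hσ => by
    rw [uIoc_of_ge hx.2] at hσ
    exact ⟨⟨hx.1.trans hσ.1.le, hσ.2⟩, hσ.1.le⟩
  have hgh : ∀ σ ∈ uIoc M x, ‖(g σ * h σ : ℂ)‖ ≤ G * B := fun σ hσ => by
    rw [norm_mul, Complex.norm_real]
    exact mul_le_mul (hgG σ (hmem σ hσ).1) (hB σ (hmem σ hσ).1) (norm_nonneg _) hG0
  refine ⟨?_, (intervalIntegral.norm_integral_le_of_norm_le_const hgh).trans hfin⟩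
  rw [fluxCorrection, norm_neg, ← intervalIntegral.integral_const_mul]
  refine (intervalIntegral.norm_integral_le_of_norm_le_const (C := G * B) fun σ hσ => ?_).trans hfin
  rw [← mul_assoc, norm_mul, ← Complex.exp_add, Complex.norm_exp]
  have : Real.exp ((-(2 * z * (θ x : ℂ)) + 2 * z * (θ σ : ℂ)).re) ≤ 1 := by
    rw [Real.exp_le_one_iff]
    have h1 := hθm hx (hmem σ hσ).1 (hmem σ hσ).2
    have : (-(2 * z * (θ x : ℂ)) + 2 * z * (θ σ : ℂ)).re = 2 * (z.re * (θ σ - θ x)) := by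
      simp; ring
    rw [this]
    nlinarith
  calc _ ≤ 1 * (G * B) := mul_le_mul this (hgh σ hσ) (norm_nonneg _) zero_le_one
    _ = G * B := one_mul _

theorem norm_volterraOp_le {G B : ℝ} (hz : z.re ≤ 0) (hθm : MonotoneOn θ (Icc 0 M))
    (hgG : ∀ x ∈ Icc 0 M, |g x| ≤ G) (hB : ∀ x ∈ Icc 0 M, ‖h x‖ ≤ B) {x : ℝ}
    (hx : x ∈ Icc 0 M) : ‖volterraOp M θ g z h x‖ ≤ G * M * B / ‖z‖ := by
  obtain ⟨h1, h2⟩ := norm_fluxCorrection_le hz hθm hgG hB hx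
  rw [volterraOp, norm_div, norm_neg, norm_mul, Complex.norm_ofNat]
  calc _ ≤ (G * M * B + G * M * B) / (2 * ‖z‖) := by
        gcongr
        exact (norm_add_le _ _).trans (add_le_add h1 h2)
    _ = G * M * B / ‖z‖ := by
        rw [← two_mul, mul_div_mul_left _ _ two_ne_zero]

theorem volterraOp_sub {h₁ h₂ : ℝ → ℂ} (hθ : ContinuousOn θ (Icc 0 M))
    (hg : ContinuousOn g (Icc 0 M)) (hh₁ : ContinuousOn h₁ (Icc 0 M))
    (hh₂ : ContinuousOn h₂ (Icc 0 M)) {x : ℝ} (hx : x ∈ Icc 0 M) :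
    volterraOp M θ g z (fun x => h₁ x - h₂ x) x =
      volterraOp M θ g z h₁ x - volterraOp M θ g z h₂ x := by
  have hMm : M ∈ Icc 0 M := right_mem_Icc.2 (hx.1.trans hx.2)
  have hgc := Complex.continuous_ofReal.comp_continuousOn hg
  have hec : ContinuousOn (fun σ => Complex.exp (2 * z * θ σ)) (Icc 0 M) :=
    Complex.continuous_exp.comp_continuousOn
      (continuousOn_const.mul (Complex.continuous_ofReal.comp_continuousOn hθ))
  have i1 := intervalIntegrable_of_continuousOn_Icc (hgc.mul hh₁) hMm hx
  have i2 := intervalIntegrable_of_continuousOn_Icc (hgc.mul hh₂) hMm hx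
  have i3 := intervalIntegrable_of_continuousOn_Icc (hec.mul (hgc.mul hh₁)) hMm hx
  have i4 := intervalIntegrable_of_continuousOn_Icc (hec.mul (hgc.mul hh₂)) hMm hx
  have e1 := intervalIntegral.integral_sub i1 i2
  have e2 := intervalIntegral.integral_sub i3 i4
  simp only [Pi.mul_apply, Function.comp_apply, ← mul_sub] at e1 e2
  simp only [volterraOp, fluxCorrection]
  rw [e1, e2]
  ring

/-- For large `|z|`, the Volterra equation `h = 1 + N h` has a solution close to `1`. -/
theorem exists_volterra_solution {G : ℝ} (hM : 0 ≤ M) (hz : z.re ≤ 0) (hz0 : z ≠ 0)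
    (hGz : 2 * (G * M) ≤ ‖z‖)
    (hθ : ∀ x ∈ Icc 0 M, HasDerivWithinAt θ (θ' x) (Icc 0 M) x) (hθm : MonotoneOn θ (Icc 0 M))
    (hg : ContinuousOn g (Icc 0 M)) (hgG : ∀ x ∈ Icc 0 M, |g x| ≤ G) :
    ∃ h m : ℝ → ℂ, (∀ x ∈ Icc 0 M, HasDerivWithinAt h (θ' x * m x) (Icc 0 M) x) ∧
      (∀ x ∈ Icc 0 M, HasDerivWithinAt m (-(2 * z * θ' x * m x) - g x * h x) (Icc 0 M) x) ∧
      (∀ x ∈ Icc 0 M, ‖h x‖ ≤ 2) ∧ (∀ x ∈ Icc 0 M, ‖h x - 1‖ ≤ 2 * (G * M) / ‖z‖) ∧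
      ∀ x ∈ Icc 0 M, ‖m x‖ ≤ 2 * (G * M) := by
  have hzpos : 0 < ‖z‖ := norm_pos_iff.2 hz0
  have hθc : ContinuousOn θ (Icc 0 M) := fun x hx => (hθ x hx).continuousWithinAt
  have hext : ∀ h : C(Icc 0 M, ℂ), ContinuousOn (IccExtend hM h) (Icc 0 M) := fun h =>
    h.continuous.Icc_extend'.continuousOn
  have hextn : ∀ (h : C(Icc 0 M, ℂ)), ∀ x ∈ Icc 0 M, ‖IccExtend hM h x‖ ≤ ‖h‖ := fun h x _ =>
    h.norm_coe_le_norm _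
  -- The assumption 2GM ≤ |z| makes this map a contraction with constant 1/2 in the sup norm. Its
  -- fixed point then satisfies ‖h‖ ≤ 1 + ‖h‖/2, which gives the bound 2.
  let F : C(Icc 0 M, ℂ) → C(Icc 0 M, ℂ) := fun h =>
    ⟨fun x => 1 + volterraOp M θ g z (IccExtend hM h) x, by
      have : ContinuousOn (volterraOp M θ g z (IccExtend hM h)) (Icc 0 M) := fun x hx =>
        (volterraOp_hasDerivWithinAt hM hz0 hθ hg (hext h) hx).continuousWithinAt
      exact continuous_const.add (continuousOn_iff_continuous_domRestrict.1 this)⟩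
  have hhalf : ∀ B : ℝ, 0 ≤ B → G * M * B / ‖z‖ ≤ 1 / 2 * B := fun B hB => by
    rw [div_le_iff₀ hzpos]
    nlinarith
  have hF : ContractingWith (1 / 2) F := by
    refine ⟨by rw [← NNReal.coe_lt_coe]; norm_num, LipschitzWith.of_dist_le_mul fun h₁ h₂ => ?_⟩
    have hb : ‖F h₁ - F h₂‖ ≤ 1 / 2 * ‖h₁ - h₂‖ := by
      refine (ContinuousMap.norm_le _ (by positivity)).2 fun x => ?_
      have e : (F h₁ - F h₂) x = volterraOp M θ g z
          (fun x => IccExtend hM h₁ x - IccExtend hM h₂ x) x := by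
        rw [volterraOp_sub hθc hg (hext h₁) (hext h₂) x.2]
        simp [F]
      rw [e]
      exact (norm_volterraOp_le hz hθm hgG (hextn (h₁ - h₂)) x.2).trans
        (hhalf _ (norm_nonneg _))
    rw [dist_eq_norm, dist_eq_norm]
    simpa using hb
  let h₀ := hF.fixedPoint F
  have hfix : F h₀ = h₀ := hF.fixedPoint_isFixedPt
  have heq : ∀ x ∈ Icc 0 M, IccExtend hM h₀ x = 1 + volterraOp M θ g z (IccExtend hM h₀) x := by
    intro x hx
    rw [IccExtend_of_mem _ _ hx]
    exact (DFunLike.congr_fun hfix ⟨x, hx⟩).symm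
  have hnorm : ‖h₀‖ ≤ 2 := by
    have h1 : ‖h₀‖ ≤ 1 + 1 / 2 * ‖h₀‖ := by
      refine (ContinuousMap.norm_le _ (by positivity)).2 fun x => ?_
      have := heq x x.2
      rw [IccExtend_of_mem _ _ x.2] at this
      rw [Subtype.coe_eta] at this
      rw [this]
      refine (norm_add_le _ _).trans ?_
      rw [norm_one]
      have := (norm_volterraOp_le hz hθm hgG (hextn h₀) x.2).trans (hhalf _ (norm_nonneg _))
      linarith
    linarith
  have hle : ∀ x ∈ Icc 0 M, ‖IccExtend hM h₀ x‖ ≤ 2 := fun x hx => (hextn h₀ x hx).trans hnorm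
  refine ⟨IccExtend hM h₀, fluxCorrection M θ g z (IccExtend hM h₀), fun x hx => ?_, fun x hx =>
    fluxCorrection_hasDerivWithinAt hM hθ hg (hext h₀) hx, hle, fun x hx => ?_, fun x hx => ?_⟩
  · exact ((volterraOp_hasDerivWithinAt hM hz0 hθ hg (hext h₀) hx).const_add 1).congr_of_mem
      heq hx
  · rw [heq x hx, add_sub_cancel_left]
    exact (norm_volterraOp_le hz hθm hgG hle hx).trans_eq (by ring)
  · exact (norm_fluxCorrection_le hz hθm hgG hle hx).1.trans_eq (by ring)

end Volterra

/-! ### WKB modes and the special family -/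

/-- The WKB ansatz `y = κ⁻¹ e^{zθ} h` turns a solution of the transport system into a mode of
`γ = κ⁴`. -/
theorem IsMode.of_transport {M : ℝ} {γ κ κ₁ κ₂ θ : ℝ → ℝ} {z : ℂ} {h m : ℝ → ℂ}
    (hγ : ∀ x ∈ Icc 0 M, γ x = κ x ^ 4) (hκ : ∀ x ∈ Icc 0 M, 0 < κ x)
    (hκ₁ : ∀ x ∈ Icc 0 M, HasDerivWithinAt κ (κ₁ x) (Icc 0 M) x)
    (hκ₂ : ∀ x ∈ Icc 0 M, HasDerivWithinAt κ₁ (κ₂ x) (Icc 0 M) x)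
    (hθ : ∀ x ∈ Icc 0 M, HasDerivWithinAt θ ((κ x ^ 2)⁻¹) (Icc 0 M) x)
    (hh : ∀ x ∈ Icc 0 M, HasDerivWithinAt h (((κ x ^ 2)⁻¹ : ℝ) * m x) (Icc 0 M) x)
    (hm : ∀ x ∈ Icc 0 M, HasDerivWithinAt m (-(2 * z * ((κ x ^ 2)⁻¹ : ℝ) * m x) -
      ((-2 * κ₁ x ^ 2 - κ x * κ₂ x : ℝ) : ℂ) * h x) (Icc 0 M) x) :
    IsMode γ M z (fun x => (κ x : ℂ)⁻¹ * Complex.exp (z * θ x) * h x)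
      (fun x => Complex.exp (z * θ x) *
        ((-(κ x : ℂ) ^ 2 * κ₁ x + z * κ x) * h x + κ x * m x)) where
  deriv x hx := by
    have hk : (κ x : ℂ) ≠ 0 := Complex.ofReal_ne_zero.2 (hκ x hx).ne'
    have d1 := (hκ₁ x hx).ofReal_comp
    have de : HasDerivWithinAt (fun x => Complex.exp (z * θ x)) _ (Icc 0 M) x :=
      (((hθ x hx).ofReal_comp).const_mul z).cexp
    refine (((d1.fun_inv hk).mul de).mul (hh x hx)).congr_deriv ?_
    rw [hγ x hx]
    push_cast
    simp only [Pi.mul_apply]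
    field_simp
  deriv_flux x hx := by
    have hk : (κ x : ℂ) ≠ 0 := Complex.ofReal_ne_zero.2 (hκ x hx).ne'
    have d1 := (hκ₁ x hx).ofReal_comp
    have d2 := (hκ₂ x hx).ofReal_comp
    have de : HasDerivWithinAt (fun x => Complex.exp (z * θ x)) _ (Icc 0 M) x :=
      (((hθ x hx).ofReal_comp).const_mul z).cexp
    have dfin := de.fun_mul (((((d1.fun_pow 2).fun_neg.fun_mul d2).fun_add (d1.const_mul z)).fun_mul
      (hh x hx)).fun_add (d1.fun_mul (hm x hx)))
    -- The terms of first order in z and those in m cancel. The terms of order zero in h cancel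
    -- exactly because the coefficient is g = -2κ'² - κκ''.
    refine dfin.congr_deriv ?_
    push_cast
    field_simp
    ring

variable {γ : ℝ → ℝ} {M : ℝ}

theorem travelTime_hasDerivWithinAt (hγ : ContinuousOn γ (Icc 0 M))
    (hγpos : ∀ x ∈ Icc 0 M, 0 < γ x) {x : ℝ} (hx : x ∈ Icc 0 M) :
    HasDerivWithinAt (travelTime γ) (1 / √(γ x)) (Icc 0 M) x :=
  hasDerivWithinAt_integral_Icc
    (continuousOn_const.div (Real.continuous_sqrt.comp_continuousOn hγ)
      fun y hy => (Real.sqrt_pos.2 (hγpos y hy)).ne') (left_mem_Icc.2 (hx.1.trans hx.2)) hx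

theorem travelTime_strictMonoOn (hγ : ContinuousOn γ (Icc 0 M))
    (hγpos : ∀ x ∈ Icc 0 M, 0 < γ x) : StrictMonoOn (travelTime γ) (Icc 0 M) := by
  refine strictMonoOn_of_deriv_pos (convex_Icc 0 M)
    (fun x hx => (travelTime_hasDerivWithinAt hγ hγpos hx).continuousWithinAt) fun x hx => ?_
  rw [interior_Icc] at hx
  rw [((travelTime_hasDerivWithinAt hγ hγpos (Ioo_subset_Icc_self hx)).hasDerivAt
    (Icc_mem_nhds hx.1 hx.2)).deriv]
  have := Real.sqrt_pos.2 (hγpos x (Ioo_subset_Icc_self hx))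
  positivity

theorem travelTime_zero : travelTime γ 0 = 0 := intervalIntegral.integral_same

/-- `y` is a mode with flux `p` that follows the WKB approximation of exponent `zθ` up to a relative
error `K / |z|`. -/
structure IsWKBMode (γ : ℝ → ℝ) (M K : ℝ) (z : ℂ) (y p : ℝ → ℂ) : Prop extends
    IsMode γ M z y p where
  bound : ∀ x ∈ Icc 0 M,
    ‖y x / (((γ x ^ (-(1 / 4) : ℝ) : ℝ) : ℂ) * Complex.exp (z * (travelTime γ x : ℂ))) - 1‖
      ≤ K / ‖z‖
  bound_flux : ∀ x ∈ Icc 0 M,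
    ‖p x / γ x / (z * ((γ x ^ (-(3 / 4) : ℝ) : ℝ) : ℂ) *
      Complex.exp (z * (travelTime γ x : ℂ))) - 1‖ ≤ K / ‖z‖

theorem exists_decaying_modes (hM : 0 < M) (hγ : ContDiffOn ℝ 2 γ (Icc 0 M))
    (hγpos : ∀ x ∈ Icc 0 M, 0 < γ x) :
    ∃ K R : ℝ, 0 < R ∧ ∀ z : ℂ, z.re ≤ 0 → R ≤ ‖z‖ →
      ∃ y p : ℝ → ℂ, IsWKBMode γ M K z y p := by
  have hu : UniqueDiffOn ℝ (Icc 0 M) := uniqueDiffOn_Icc hM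
  let κ : ℝ → ℝ := fun x => γ x ^ (1 / 4 : ℝ)
  have hκ : ContDiffOn ℝ 2 κ (Icc 0 M) := hγ.rpow_const_of_ne fun x hx => (hγpos x hx).ne'
  have hκpos : ∀ x ∈ Icc 0 M, 0 < κ x := fun x hx => Real.rpow_pos_of_pos (hγpos x hx) _
  have hκ1 : ContDiffOn ℝ 1 (derivWithin κ (Icc 0 M)) (Icc 0 M) :=
    ((contDiffOn_succ_iff_derivWithin (n := 1) hu).1 hκ).2.2
  have hκ2 : ContinuousOn (derivWithin (derivWithin κ (Icc 0 M)) (Icc 0 M)) (Icc 0 M) :=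
    hκ1.continuousOn_derivWithin hu le_rfl
  set κ₁ := derivWithin κ (Icc 0 M)
  set κ₂ := derivWithin κ₁ (Icc 0 M)
  have d1 : ∀ x ∈ Icc 0 M, HasDerivWithinAt κ (κ₁ x) (Icc 0 M) x := fun x hx =>
    (hκ.differentiableOn (by norm_num) x hx).hasDerivWithinAt
  have d2 : ∀ x ∈ Icc 0 M, HasDerivWithinAt κ₁ (κ₂ x) (Icc 0 M) x := fun x hx =>
    (hκ1.differentiableOn (by norm_num) x hx).hasDerivWithinAt
  have pow4 : ∀ x ∈ Icc 0 M, γ x = κ x ^ 4 := fun x hx => by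
    simp only [κ]
    rw [← Real.rpow_natCast, ← Real.rpow_mul (hγpos x hx).le]; norm_num
  have pow2 : ∀ x ∈ Icc 0 M, √(γ x) = κ x ^ 2 := fun x hx => by
    rw [pow4 x hx, show κ x ^ 4 = (κ x ^ 2) ^ 2 by ring, Real.sqrt_sq (by positivity)]
  have powm1 : ∀ x ∈ Icc 0 M, γ x ^ (-(1 / 4) : ℝ) = (κ x)⁻¹ := fun x hx =>
    Real.rpow_neg (hγpos x hx).le _
  have powm3 : ∀ x ∈ Icc 0 M, γ x ^ (-(3 / 4) : ℝ) = (κ x ^ 3)⁻¹ := fun x hx => by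
    simp only [κ]
    rw [Real.rpow_neg (hγpos x hx).le, ← Real.rpow_natCast, ← Real.rpow_mul (hγpos x hx).le]
    norm_num
  have hθ : ∀ x ∈ Icc 0 M, HasDerivWithinAt (travelTime γ) ((κ x ^ 2)⁻¹) (Icc 0 M) x :=
    fun x hx => by
      have := travelTime_hasDerivWithinAt hγ.continuousOn hγpos hx
      rwa [pow2 x hx, one_div] at this
  have hgc : ContinuousOn (fun x => -2 * κ₁ x ^ 2 - κ x * κ₂ x) (Icc 0 M) :=
    (continuousOn_const.mul (hκ1.continuousOn.pow 2)).sub (hκ.continuousOn.mul hκ2)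
  obtain ⟨G, hG⟩ := isCompact_Icc.exists_bound_of_continuousOn hgc
  obtain ⟨C, hC⟩ := isCompact_Icc.exists_bound_of_continuousOn (hκ.continuousOn.mul hκ1.continuousOn)
  have hG0 : 0 ≤ G := (norm_nonneg _).trans (hG 0 (left_mem_Icc.2 hM.le))
  have hC0 : 0 ≤ C := (norm_nonneg _).trans (hC 0 (left_mem_Icc.2 hM.le))
  -- R is the contraction threshold 2GM, increased by 1 to stay positive. In the flux error, |h - 1|
  -- contributes 2GM/|z|, and (m - κκ'h)/z contributes (2GM + 2C)/|z|, using |h| ≤ 2.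
  refine ⟨4 * (G * M) + 2 * C, 2 * (G * M) + 1, by positivity, fun z hz hzR => ?_⟩
  have hzpos : 0 < ‖z‖ := lt_of_lt_of_le (by positivity) hzR
  have hz0 : z ≠ 0 := norm_pos_iff.1 hzpos
  obtain ⟨h, m, hh, hm, hb2, hb1, hbm⟩ := exists_volterra_solution hM.le hz hz0
    (by linarith : 2 * (G * M) ≤ ‖z‖) hθ
    (travelTime_strictMonoOn hγ.continuousOn hγpos).monotoneOn hgc hG
  have hk : ∀ x ∈ Icc 0 M, (κ x : ℂ) ≠ 0 := fun x hx =>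
    Complex.ofReal_ne_zero.2 (hκpos x hx).ne'
  refine ⟨_, _, IsMode.of_transport pow4 hκpos d1 d2 hθ hh hm, fun x hx => ?_, fun x hx => ?_⟩
  · rw [powm1 x hx]
    have : (κ x : ℂ)⁻¹ * Complex.exp (z * travelTime γ x) * h x /
        (((κ x)⁻¹ : ℝ) * Complex.exp (z * travelTime γ x)) - 1 = h x - 1 := by
      have := hk x hx
      have he : Complex.exp (z * travelTime γ x) ≠ 0 := Complex.exp_ne_zero _
      push_cast
      field_simp
    rw [this]
    refine (hb1 x hx).trans ?_
    gcongr
    nlinarith [mul_nonneg hG0 hM.le]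
  · rw [powm3 x hx, pow4 x hx]
    have : Complex.exp (z * travelTime γ x) *
        ((-(κ x : ℂ) ^ 2 * κ₁ x + z * κ x) * h x + κ x * m x) / (κ x ^ 4 : ℝ) /
        (z * ((κ x ^ 3)⁻¹ : ℝ) * Complex.exp (z * travelTime γ x)) - 1 =
        (h x - 1) + (m x - (κ x * κ₁ x : ℝ) * h x) / z := by
      have := hk x hx
      have he : Complex.exp (z * travelTime γ x) ≠ 0 := Complex.exp_ne_zero _
      push_cast
      field_simp
      ring
    rw [this]
    have h3 : ‖m x - (κ x * κ₁ x : ℝ) * h x‖ ≤ 2 * (G * M) + C * 2 := by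
      refine (norm_sub_le _ _).trans (add_le_add (hbm x hx) ?_)
      rw [norm_mul, Complex.norm_real]
      exact mul_le_mul (hC x hx) (hb2 x hx) (norm_nonneg _) hC0
    calc _ ≤ 2 * (G * M) / ‖z‖ + (2 * (G * M) + C * 2) / ‖z‖ := by
          refine (norm_add_le _ _).trans (add_le_add (hb1 x hx) ?_)
          rw [norm_div]
          gcongr
      _ = (4 * (G * M) + 2 * C) / ‖z‖ := by rw [← add_div]; ring_nf

theorem IsMode.derivWithin_eq (hM : 0 < M) {z : ℂ} {y p : ℝ → ℂ} (h : IsMode γ M z y p) {x : ℝ}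
    (hx : x ∈ Icc 0 M) : derivWithin y (Icc 0 M) x = p x / γ x :=
  (h.deriv x hx).derivWithin (uniqueDiffOn_Icc hM x hx)

theorem IsMode.ode (hM : 0 < M) (hγpos : ∀ x ∈ Icc 0 M, 0 < γ x) {z : ℂ} {y p : ℝ → ℂ}
    (h : IsMode γ M z y p) {x : ℝ} (hx : x ∈ Icc 0 M) :
    derivWithin (fun x => (γ x : ℂ) * derivWithin y (Icc 0 M) x) (Icc 0 M) x
      - z ^ 2 * y x = 0 := by
  have e : ∀ t ∈ Icc 0 M, (γ t : ℂ) * derivWithin y (Icc 0 M) t = p t := fun t ht => by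
    rw [h.derivWithin_eq hM ht, mul_div_cancel₀ _ (Complex.ofReal_ne_zero.2 (hγpos t ht).ne')]
  rw [derivWithin_congr e (e x hx),
    (h.deriv_flux x hx).derivWithin (uniqueDiffOn_Icc hM x hx), sub_self]

theorem IsMode.contDiffOn (hM : 0 < M) (hγ : ContDiffOn ℝ 2 γ (Icc 0 M))
    (hγpos : ∀ x ∈ Icc 0 M, 0 < γ x) {z : ℂ} {y p : ℝ → ℂ}
    (h : IsMode γ M z y p) : ContDiffOn ℝ 2 y (Icc 0 M) := by
  have hu : UniqueDiffOn ℝ (Icc 0 M) := uniqueDiffOn_Icc hM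
  have hp : ContDiffOn ℝ 1 p (Icc 0 M) := by
    refine (contDiffOn_succ_iff_derivWithin (n := 0) hu).2
      ⟨fun x hx => (h.deriv_flux x hx).differentiableWithinAt, by simp, ?_⟩
    rw [contDiffOn_zero]
    exact (continuousOn_const.mul h.continuousOn).congr
      fun x hx => (h.deriv_flux x hx).derivWithin (hu x hx)
  refine (contDiffOn_succ_iff_derivWithin (n := 1) hu).2
    ⟨fun x hx => (h.deriv x hx).differentiableWithinAt, by simp, ?_⟩
  have hγ1 : ContDiffOn ℝ 1 (fun x => (γ x : ℂ)) (Icc 0 M) :=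
    Complex.ofRealCLM.contDiff.comp_contDiffOn (hγ.of_le (by norm_num))
  have := hp.mul (hγ1.inv fun x hx => Complex.ofReal_ne_zero.2 (hγpos x hx).ne')
  exact this.congr fun x hx => by rw [h.derivWithin_eq hM hx, div_eq_mul_inv]; rfl

theorem exists_isSpecialFamily (hM : 0 < M) (hγ : ContDiffOn ℝ 2 γ (Icc 0 M))
    (hγpos : ∀ x ∈ Icc 0 M, 0 < γ x) : ∃ Ψ : ℂ → ℝ → ℂ, IsSpecialFamily γ M Ψ := by
  obtain ⟨K, R, hR, hex⟩ := exists_decaying_modes hM hγ hγpos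
  choose! y p hm using hex
  classical
  -- The asymptotics constrain only large |z|; below R the zero solution serves.
  refine ⟨fun z => if R ≤ ‖z‖ then y z else 0, ?_, ?_, K, R, hR, ?_⟩
  · intro z hz
    by_cases h : R ≤ ‖z‖
    · simp only [h, if_true]
      exact (hm z hz h).toIsMode.contDiffOn hM hγ hγpos
    · simp only [h, if_false]
      exact contDiffOn_const
  · intro z hz x hx
    by_cases h : R ≤ ‖z‖
    · simp only [h, if_true]
      exact (hm z hz h).toIsMode.ode hM hγpos hx
    · have e : derivWithin (0 : ℝ → ℂ) (Icc 0 M) = 0 := derivWithin_const _ (0 : ℂ)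
      simp [h, e]
  · intro z hz h x hx
    simp only [h, if_true]
    rw [(hm z hz h).toIsMode.derivWithin_eq hM hx]
    exact ⟨(hm z hz h).bound x hx, (hm z hz h).bound_flux x hx⟩

/-- The members of a special family are modes. -/
theorem IsSpecialFamily.isMode (hM : 0 < M) (hγ : ContDiffOn ℝ 2 γ (Icc 0 M))
    (hγpos : ∀ x ∈ Icc 0 M, 0 < γ x) {Ψ : ℂ → ℝ → ℂ} (h : IsSpecialFamily γ M Ψ) {z : ℂ}
    (hz : z.re ≤ 0) :
    IsMode γ M z (Ψ z) (fun x => γ x * derivWithin (Ψ z) (Icc 0 M) x) where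
  deriv x hx := by
    rw [mul_div_cancel_left₀ _ (Complex.ofReal_ne_zero.2 (hγpos x hx).ne')]
    exact ((h.contDiffOn z hz).differentiableOn (by norm_num) x hx).hasDerivWithinAt
  deriv_flux x hx := by
    have hu : UniqueDiffOn ℝ (Icc 0 M) := uniqueDiffOn_Icc hM
    have d1 : ContDiffOn ℝ 1 (derivWithin (Ψ z) (Icc 0 M)) (Icc 0 M) :=
      ((contDiffOn_succ_iff_derivWithin (n := 1) hu).1 (h.contDiffOn z hz)).2.2
    have hγ1 : ContDiffOn ℝ 1 (fun x => (γ x : ℂ)) (Icc 0 M) :=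
      Complex.ofRealCLM.contDiff.comp_contDiffOn (hγ.of_le (by norm_num))
    have := ((hγ1.mul d1).differentiableOn (by norm_num) x hx).hasDerivWithinAt
    rw [← sub_eq_zero.1 (h.ode z hz x hx)]
    exact this

theorem IsSpecialFamily.exists_isWKBMode (hM : 0 < M) (hγ : ContDiffOn ℝ 2 γ (Icc 0 M))
    (hγpos : ∀ x ∈ Icc 0 M, 0 < γ x) {Ψ : ℂ → ℝ → ℂ} (h : IsSpecialFamily γ M Ψ) :
    ∃ K R : ℝ, 0 < R ∧ ∀ z : ℂ, z.re ≤ 0 → R ≤ ‖z‖ →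
      IsWKBMode γ M K z (Ψ z) (fun x => γ x * derivWithin (Ψ z) (Icc 0 M) x) := by
  obtain ⟨K, R, hR, hb⟩ := h.asymptotics
  refine ⟨K, R, hR, fun z hz hzR => ⟨h.isMode hM hγ hγpos hz, fun x hx => (hb z hz hzR x hx).1,
    fun x hx => ?_⟩⟩
  rw [mul_div_cancel_left₀ _ (Complex.ofReal_ne_zero.2 (hγpos x hx).ne')]
  exact (hb z hz hzR x hx).2

theorem travelTime_reflect (hγ : ContinuousOn γ (Icc 0 M)) (hγpos : ∀ x ∈ Icc 0 M, 0 < γ x) {x : ℝ}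
    (hx : x ∈ Icc 0 M) :
    travelTime (fun x => γ (M - x)) (M - x) = travelTime γ M - travelTime γ x := by
  have h0 : (0 : ℝ) ∈ Icc 0 M := left_mem_Icc.2 (hx.1.trans hx.2)
  have hM : M ∈ Icc 0 M := right_mem_Icc.2 (hx.1.trans hx.2)
  have hc : ContinuousOn (fun y => 1 / √(γ y)) (Icc 0 M) :=
    continuousOn_const.div (Real.continuous_sqrt.comp_continuousOn hγ)
      fun y hy => (Real.sqrt_pos.2 (hγpos y hy)).ne'
  simp only [travelTime]
  rw [intervalIntegral.integral_comp_sub_left (fun y => 1 / √(γ y)) M,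
    intervalIntegral.integral_interval_sub_left
      (intervalIntegrable_of_continuousOn_Icc hc h0 hM)
      (intervalIntegrable_of_continuousOn_Icc hc h0 hx)]
  simp

/-- Modes growing away from `0`, by reflection of decaying ones. -/
theorem exists_growing_modes (hM : 0 < M) (hγ : ContDiffOn ℝ 2 γ (Icc 0 M))
    (hγpos : ∀ x ∈ Icc 0 M, 0 < γ x) :
    ∃ K R : ℝ, 0 < R ∧ ∀ z : ℂ, z.re ≤ 0 → R ≤ ‖z‖ →
      ∃ y p : ℝ → ℂ, IsWKBMode γ M K (-z) y p := by
  have hmaps : MapsTo (fun x => M - x) (Icc 0 M) (Icc 0 M) := fun x hx =>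
    ⟨by linarith [hx.2], by linarith [hx.1]⟩
  have hγr : ContDiffOn ℝ 2 (fun x => γ (M - x)) (Icc 0 M) :=
    hγ.comp (contDiff_const.sub contDiff_id).contDiffOn hmaps
  obtain ⟨K, R, hR, hex⟩ := exists_decaying_modes hM hγr fun x hx => hγpos _ (hmaps hx)
  refine ⟨K, R, hR, fun z hz hzR => ?_⟩
  obtain ⟨y, p, hyp⟩ := hex z hz hzR
  -- Reflection turns θ(x) into θ(M) - θ(x); multiplying by E removes the factor e^{zθ(M)} and
  -- leaves e^{-zθ(x)}.
  set E := Complex.exp (-(z * travelTime γ M)) with hE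
  have hsub : ∀ x, M - (M - x) = x := fun x => by ring
  have hd : ∀ x, HasDerivWithinAt (fun x : ℝ => M - x) (-1) (Icc 0 M) x := fun x =>
    ((hasDerivAt_id x).const_sub M).hasDerivWithinAt
  have hexp : ∀ x ∈ Icc 0 M, Complex.exp (z * (travelTime γ M - travelTime γ x : ℝ)) * E =
      Complex.exp (-z * travelTime γ x) := fun x hx => by
    rw [hE, ← Complex.exp_add]
    congr 1
    push_cast
    ring
  refine ⟨fun x => E * y (M - x), fun x => -(E * p (M - x)), ⟨fun x hx => ?_, fun x hx => ?_⟩,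
    fun x hx => ?_, fun x hx => ?_⟩
  · have := (hyp.deriv (M - x) (hmaps hx)).scomp x (hd x) hmaps
    refine (this.const_mul E).congr_deriv ?_
    rw [hsub]
    simp
    ring
  · have := (hyp.deriv_flux (M - x) (hmaps hx)).scomp x (hd x) hmaps
    refine (this.const_mul E).neg.congr_deriv ?_
    simp
    ring
  · have := hyp.bound (M - x) (hmaps hx)
    rw [hsub, travelTime_reflect hγ.continuousOn hγpos hx] at this
    rw [norm_neg]
    convert this using 3
    rw [← hexp x hx, mul_comm E, ← mul_assoc, mul_div_mul_right _ _ (Complex.exp_ne_zero _)]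
  · have := hyp.bound_flux (M - x) (hmaps hx)
    rw [hsub, travelTime_reflect hγ.continuousOn hγpos hx] at this
    rw [norm_neg]
    convert this using 3
    rw [← hexp x hx, neg_mul, ← mul_assoc, neg_mul, neg_mul, neg_div, neg_div, div_neg, neg_neg,
      mul_comm E, mul_div_right_comm, mul_div_mul_right _ _ (Complex.exp_ne_zero _)]

/-! ### Limits of the scaled boundary values of the modes -/

section Limits

variable {γ : ℝ → ℝ} {M K : ℝ} {l : Filter ℝ} {w : ℝ → ℂ} {y p : ℝ → ℝ → ℂ}

theorem tendsto_one_of_norm_sub_le (hw : Tendsto (fun τ => ‖w τ‖) l atTop) {f : ℝ → ℂ}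
    (h : ∀ᶠ τ in l, ‖f τ - 1‖ ≤ K / ‖w τ‖) : Tendsto f l (𝓝 1) := by
  rw [tendsto_iff_norm_sub_tendsto_zero]
  exact squeeze_zero' (Eventually.of_forall fun _ => norm_nonneg _) h (hw.const_div_atTop K)

theorem tendsto_mode_div_exp (hγpos : ∀ x ∈ Icc 0 M, 0 < γ x)
    (hw : Tendsto (fun τ => ‖w τ‖) l atTop)
    (hy : ∀ᶠ τ in l, IsWKBMode γ M K (w τ) (y τ) (p τ)) {x : ℝ} (hx : x ∈ Icc 0 M) :
    Tendsto (fun τ => y τ x / Complex.exp (w τ * travelTime γ x)) l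
      (𝓝 ((γ x ^ (-(1 / 4) : ℝ) : ℝ) : ℂ)) := by
  have h1 := (tendsto_one_of_norm_sub_le hw (hy.mono fun τ h => h.bound x hx)).const_mul
    ((γ x ^ (-(1 / 4) : ℝ) : ℝ) : ℂ)
  rw [mul_one] at h1
  refine h1.congr fun τ => ?_
  have : ((γ x ^ (-(1 / 4) : ℝ) : ℝ) : ℂ) ≠ 0 :=
    Complex.ofReal_ne_zero.2 (Real.rpow_pos_of_pos (hγpos x hx) _).ne'
  have he := Complex.exp_ne_zero (w τ * travelTime γ x)
  field_simp

theorem tendsto_flux_div_exp (hγpos : ∀ x ∈ Icc 0 M, 0 < γ x)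
    (hw : Tendsto (fun τ => ‖w τ‖) l atTop)
    (hy : ∀ᶠ τ in l, IsWKBMode γ M K (w τ) (y τ) (p τ)) {x : ℝ} (hx : x ∈ Icc 0 M) :
    Tendsto (fun τ => p τ x / (w τ * Complex.exp (w τ * travelTime γ x))) l
      (𝓝 ((γ x ^ (1 / 4 : ℝ) : ℝ) : ℂ)) := by
  have hg := hγpos x hx
  have h1 := (tendsto_one_of_norm_sub_le hw (hy.mono fun τ h => h.bound_flux x hx)).const_mul
    ((γ x * γ x ^ (-(3 / 4) : ℝ) : ℝ) : ℂ)
  have e : γ x * γ x ^ (-(3 / 4) : ℝ) = γ x ^ (1 / 4 : ℝ) := by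
    nth_rewrite 1 [← Real.rpow_one (γ x)]
    rw [← Real.rpow_add hg]
    norm_num
  rw [mul_one] at h1
  rw [← e]
  refine h1.congr fun τ => ?_
  have h2 : ((γ x ^ (-(3 / 4) : ℝ) : ℝ) : ℂ) ≠ 0 :=
    Complex.ofReal_ne_zero.2 (Real.rpow_pos_of_pos hg _).ne'
  have h3 : (γ x : ℂ) ≠ 0 := Complex.ofReal_ne_zero.2 hg.ne'
  push_cast
  rw [mul_right_comm (w τ), mul_div_assoc', mul_right_comm, mul_div_cancel₀ _ h3,
    mul_div_mul_right _ _ h2]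

/-- Once K/|w| ≤ 1 the relative error is at most 1, so the mode is at most twice its leading term,
uniformly in x. -/
theorem exists_norm_mode_le (hγ : ContinuousOn γ (Icc 0 M)) (hγpos : ∀ x ∈ Icc 0 M, 0 < γ x)
    (hw : Tendsto (fun τ => ‖w τ‖) l atTop)
    (hy : ∀ᶠ τ in l, IsWKBMode γ M K (w τ) (y τ) (p τ)) :
    ∃ C : ℝ, 0 ≤ C ∧ ∀ᶠ τ in l, ∀ x ∈ Icc 0 M,
      ‖y τ x‖ ≤ C * Real.exp ((w τ).re * travelTime γ x) := by
  have hc : ContinuousOn (fun x => γ x ^ (-(1 / 4) : ℝ)) (Icc 0 M) :=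
    hγ.rpow_const fun x hx => Or.inl (hγpos x hx).ne'
  obtain ⟨A, hA⟩ := isCompact_Icc.exists_bound_of_continuousOn hc
  have hK : ∀ᶠ τ in l, K / ‖w τ‖ ≤ 1 :=
    ((hw.const_div_atTop K).eventually (gt_mem_nhds one_pos)).mono fun _ h => h.le
  refine ⟨2 * |A|, by positivity, ?_⟩
  filter_upwards [hy, hK] with τ h hk x hx
  set D : ℂ := ((γ x ^ (-(1 / 4) : ℝ) : ℝ) : ℂ) * Complex.exp (w τ * travelTime γ x)
  have hD : D ≠ 0 := mul_ne_zero
    (Complex.ofReal_ne_zero.2 (Real.rpow_pos_of_pos (hγpos x hx) _).ne') (Complex.exp_ne_zero _)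
  have h1 : ‖y τ x / D‖ ≤ 2 := by
    have := norm_add_le (y τ x / D - 1) 1
    rw [sub_add_cancel, norm_one] at this
    linarith [(h.bound x hx).trans hk]
  have h2 : ‖D‖ ≤ |A| * Real.exp ((w τ).re * travelTime γ x) := by
    rw [norm_mul, Complex.norm_real, Complex.norm_exp]
    have : (w τ * (travelTime γ x : ℂ)).re = (w τ).re * travelTime γ x := by simp
    rw [this]
    gcongr
    exact (hA x hx).trans (le_abs_self A)
  calc ‖y τ x‖ = ‖y τ x / D‖ * ‖D‖ := by rw [← norm_mul, div_mul_cancel₀ _ hD]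
    _ ≤ 2 * (|A| * Real.exp ((w τ).re * travelTime γ x)) := by gcongr
    _ = _ := by ring

/-- The flux is of order w e^{wθ} and the mode only of order e^{wθ}, so the Robin term disappears in
the limit. -/
theorem tendsto_robin_div_exp (hγpos : ∀ x ∈ Icc 0 M, 0 < γ x)
    (hw : Tendsto (fun τ => ‖w τ‖) l atTop)
    (hy : ∀ᶠ τ in l, IsWKBMode γ M K (w τ) (y τ) (p τ)) {x : ℝ} (hx : x ∈ Icc 0 M) (ρ : ℝ) :
    Tendsto (fun τ => (p τ x + ρ * y τ x) / (w τ * Complex.exp (w τ * travelTime γ x))) l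
      (𝓝 ((γ x ^ (1 / 4 : ℝ) : ℝ) : ℂ)) := by
  have h1 := tendsto_flux_div_exp hγpos hw hy hx
  have h2 := tendsto_mode_div_exp hγpos hw hy hx
  have h3 : Tendsto (fun τ => (ρ : ℂ) / w τ) l (𝓝 0) := by
    rw [tendsto_zero_iff_norm_tendsto_zero]
    simp only [norm_div]
    exact hw.const_div_atTop _
  have h4 := h1.add (h3.mul h2)
  rw [zero_mul, add_zero] at h4
  refine h4.congr fun τ => ?_
  rw [add_div, mul_div_mul_comm]

end Limits

/-! ### Exponential rates and elementary bounds -/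

theorem tendsto_log_div_of_le {J : ℝ → ℝ} {c C μ : ℝ} (hc : 0 < c)
    (h1 : ∀ᶠ τ in atTop, c * τ ^ μ ≤ J τ) (h2 : ∀ᶠ τ in atTop, J τ ≤ C) :
    Tendsto (fun τ => Real.log (J τ) / τ) atTop (𝓝 0) := by
  have hlog : Tendsto (fun τ : ℝ => Real.log τ / τ) atTop (𝓝 0) :=
    Real.isLittleO_log_id_atTop.tendsto_div_nhds_zero
  have hinv : ∀ k : ℝ, Tendsto (fun τ : ℝ => k / τ) atTop (𝓝 0) := fun k =>
    tendsto_id.const_div_atTop k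
  have hlow : Tendsto (fun τ : ℝ => Real.log c / τ + μ * (Real.log τ / τ)) atTop (𝓝 0) := by
    simpa using (hinv (Real.log c)).add (hlog.const_mul μ)
  refine tendsto_of_tendsto_of_tendsto_of_le_of_le' hlow (hinv (Real.log C)) ?_ ?_
  · filter_upwards [h1, eventually_gt_atTop 0] with τ h hτ
    have hp : 0 < τ ^ μ := Real.rpow_pos_of_pos hτ _
    have : Real.log c + μ * Real.log τ ≤ Real.log (J τ) := by
      rw [← Real.log_rpow hτ, ← Real.log_mul hc.ne' hp.ne']
      exact Real.log_le_log (by positivity) h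
    rw [mul_div_assoc', ← add_div]
    gcongr
  · filter_upwards [h1, h2, eventually_gt_atTop 0] with τ h h' hτ
    have hp : 0 < τ ^ μ := Real.rpow_pos_of_pos hτ _
    have hJ : 0 < J τ := lt_of_lt_of_le (by positivity) h
    gcongr

/-- If `Q` has a nonzero limit, `F` is bounded and at least polynomially large, and `r` decays
exponentially, then `Q F + r` has exponential rate zero. -/
theorem tendsto_log_norm_div {Q F r : ℝ → ℂ} {q : ℂ} {c C μ δ : ℝ} (hq : q ≠ 0) (hc : 0 < c)
    (hδ : 0 < δ) (hQ : Tendsto Q atTop (𝓝 q)) (hF : ∀ᶠ τ in atTop, c * τ ^ μ ≤ ‖F τ‖)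
    (hF' : ∀ᶠ τ in atTop, ‖F τ‖ ≤ C) (hr : r =O[atTop] fun τ => Real.exp (-δ * τ)) :
    (∀ᶠ τ in atTop, Q τ * F τ + r τ ≠ 0) ∧
      Tendsto (fun τ => Real.log ‖Q τ * F τ + r τ‖ / τ) atTop (𝓝 0) := by
  have hq0 : 0 < ‖q‖ := norm_pos_iff.2 hq
  have hro := hr.trans_isLittleO (isLittleO_exp_neg_mul_rpow_atTop hδ μ)
  -- QF is at least half of ‖q‖cτ^μ, and exponential decay beats every power of τ, so r uses up at
  -- most half of that, leaving ‖q‖c/4.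
  have hr1 := (hro.def (c := ‖q‖ * c / 4) (by positivity))
  have hr0 : ∀ᶠ τ in atTop, ‖r τ‖ ≤ 1 := by
    have h0 : Tendsto (fun τ : ℝ => Real.exp (-δ * τ)) atTop (𝓝 0) := by
      have h1 := Real.tendsto_exp_neg_atTop_nhds_zero.comp (tendsto_id.const_mul_atTop hδ)
      exact h1.congr fun τ => by simp
    have := hr.trans_tendsto h0
    rw [tendsto_zero_iff_norm_tendsto_zero] at this
    exact (this.eventually (gt_mem_nhds one_pos)).mono fun _ h => h.le
  have hQ1 : ∀ᶠ τ in atTop, ‖q‖ / 2 < ‖Q τ‖ := hQ.norm.eventually (lt_mem_nhds (by linarith))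
  have hQ2 : ∀ᶠ τ in atTop, ‖Q τ‖ < 2 * ‖q‖ := hQ.norm.eventually (gt_mem_nhds (by linarith))
  have hlow : ∀ᶠ τ in atTop, ‖q‖ * c / 4 * τ ^ μ ≤ ‖Q τ * F τ + r τ‖ := by
    filter_upwards [hQ1, hF, hr1, eventually_gt_atTop 0] with τ a1 a2 a3 hτ
    have hp : 0 < τ ^ μ := Real.rpow_pos_of_pos hτ _
    rw [Real.norm_of_nonneg hp.le] at a3
    have h1 : ‖q‖ / 2 * (c * τ ^ μ) ≤ ‖Q τ * F τ‖ := by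
      rw [norm_mul]
      exact mul_le_mul a1.le a2 (by positivity) (norm_nonneg _)
    have h2 := norm_sub_norm_le (Q τ * F τ) (-r τ)
    rw [sub_neg_eq_add, norm_neg] at h2
    linarith
  refine ⟨?_, tendsto_log_div_of_le (c := ‖q‖ * c / 4) (C := 2 * ‖q‖ * C + 1) (μ := μ)
    (by positivity) hlow ?_⟩
  · filter_upwards [hlow, eventually_gt_atTop 0] with τ h hτ
    have hp : 0 < τ ^ μ := Real.rpow_pos_of_pos hτ _
    exact norm_pos_iff.1 (lt_of_lt_of_le (by positivity) h)
  · filter_upwards [hQ2, hF', hr0] with τ a1 a2 a3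
    refine (norm_add_le _ _).trans (add_le_add ?_ a3)
    rw [norm_mul]
    exact mul_le_mul a1.le a2 (norm_nonneg _) (by positivity)

theorem norm_pairing_le {a M B : ℝ} (haM : a ≤ M) {f : ℝ → ℝ} {y : ℝ → ℂ}
    (hf : IntegrableOn f (Ioo 0 a)) (hy : ∀ x ∈ Icc 0 M, ‖y x‖ ≤ B) :
    ‖∫ x in Ioo 0 a, (f x : ℂ) * y x‖ ≤ B * ∫ x in Ioo 0 a, ‖f x‖ := by
  rw [← integral_const_mul]
  refine norm_integral_le_of_norm_le (hf.norm.const_mul B) ?_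
  refine (ae_restrict_iff' measurableSet_Ioo).2 (Eventually.of_forall fun x hx => ?_)
  rw [norm_mul, Complex.norm_real, mul_comm]
  gcongr
  exact hy x ⟨hx.1.le, hx.2.le.trans haM⟩

theorem norm_laplace_le {T : ℝ} (hT : 0 ≤ T) {f : ℝ → ℝ} (hf : IntegrableOn f (Ioo 0 T)) {z : ℂ}
    (hz : 0 ≤ (z ^ 2).re) :
    ‖∫ t in (0 : ℝ)..T, Complex.exp (-z ^ 2 * t) * (f t : ℂ)‖ ≤ ∫ t in Ioo 0 T, ‖f t‖ := by
  rw [← setIntegral_Ioo_eq hT]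
  refine norm_integral_le_of_norm_le hf.norm ?_
  refine (ae_restrict_iff' measurableSet_Ioo).2 (Eventually.of_forall fun t ht => ?_)
  rw [norm_mul, Complex.norm_real, Complex.norm_exp]
  refine mul_le_of_le_one_left (norm_nonneg _) ?_
  rw [Real.exp_le_one_iff]
  have : (-z ^ 2 * (t : ℂ)).re = -((z ^ 2).re * t) := by simp
  rw [this]
  nlinarith [ht.1]

/-! ### Elimination of the boundary values and the rate of the indicator function -/

theorem indicatorFn_eq {γ : ℝ → ℝ} {ρ a M T : ℝ} {u ux : ℝ → ℝ → ℝ} {f₀ f₁ : ℝ → ℝ}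
    (hs : IsSolution γ ρ a T u ux f₀ f₁) (ha : 0 < a) (hM : 0 < M) (hT : 0 < T)
    {Ψ : ℂ → ℝ → ℂ} {z : ℂ} (hd : DifferentiableOn ℝ (Ψ z) (Icc 0 M)) :
    indicatorFn γ M T Ψ u f₀ z =
      -(γ 0 * derivWithin (Ψ z) (Icc 0 M) 0) *
        (∫ t in (0 : ℝ)..T, Complex.exp (-z ^ 2 * t) * (u 0 t : ℂ)) +
      γ 0 * Ψ z 0 * ∫ t in (0 : ℝ)..T, Complex.exp (-z ^ 2 * t) * (f₀ t : ℂ) := by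
  have i0 := integrable_exp_mul (z := z) hT.le (hs.integrable_trace ha 0 (Or.inl rfl))
  have if0 := integrable_exp_mul (z := z) hT.le (integrableOn_of_memLp_two hs.memLp_flux_zero)
  rw [indicatorFn, ← intervalIntegral.integral_const_mul, ← intervalIntegral.integral_const_mul,
    ← intervalIntegral.integral_add (i0.const_mul _) (if0.const_mul _)]
  congr 1; ext t
  have : derivWithin (fun x => backwardSol Ψ z x t) (Icc 0 M) 0 =
      Complex.exp (-z ^ 2 * t) * derivWithin (Ψ z) (Icc 0 M) 0 :=
    derivWithin_const_mul _ (hd 0 (left_mem_Icc.2 hM.le))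
  rw [this, backwardSol]
  ring

/-- Elimination of the unknown boundary values from the two Green identities; `e = e^{zθ(a)}` and
the boundary values of the modes are scaled by their leading exponentials. -/
theorem indicator_elimination {z e b₁ b₂ q₁ q₂ y₁ y₂ g F U₀ Ua E₁ E₂ I : ℂ} (he : e ≠ 0)
    (hd : q₁ * b₂ - q₂ * b₁ * e ^ 2 ≠ 0)
    (h₁ : E₁ = -(z * e * b₁) * Ua - g * y₁ * F + z * q₁ * U₀)
    (h₂ : E₂ = -(-z * e⁻¹ * b₂) * Ua - g * y₂ * F + -z * q₂ * U₀)
    (hI : I = -(z * q₁) * U₀ + g * y₁ * F) :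
    I / e ^ 2 = -(b₁ / (q₁ * b₂ - q₂ * b₁ * e ^ 2)) * g * (q₂ * y₁ + q₁ * y₂) * F +
      (-(b₁ / (q₁ * b₂ - q₂ * b₁ * e ^ 2)) * (q₂ * E₁ + q₁ * E₂) - E₁ / e ^ 2) := by
  -- In q₂·`h₁` + q₁·`h₂` the contributions of U₀ cancel, and the coefficient of U_a is -(z/e)(q₁b₂
  -- - q₂b₁e²).
  have h3 : g * (q₂ * y₁ + q₁ * y₂) * F + (q₂ * E₁ + q₁ * E₂) =
      (q₁ * b₂ - q₂ * b₁ * e ^ 2) * (z / e * Ua) := by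
    rw [h₁, h₂]
    field_simp
    ring
  have h4 : I = -(z * e * b₁) * Ua - E₁ := by rw [hI, h₁]; ring
  have h5 : -(b₁ / (q₁ * b₂ - q₂ * b₁ * e ^ 2)) * g * (q₂ * y₁ + q₁ * y₂) * F +
      (-(b₁ / (q₁ * b₂ - q₂ * b₁ * e ^ 2)) * (q₂ * E₁ + q₁ * E₂) - E₁ / e ^ 2) =
      -(b₁ / (q₁ * b₂ - q₂ * b₁ * e ^ 2)) *
        (g * (q₂ * y₁ + q₁ * y₂) * F + (q₂ * E₁ + q₁ * E₂)) - E₁ / e ^ 2 := by ring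
  have h6 : -(b₁ / (q₁ * b₂ - q₂ * b₁ * e ^ 2)) *
      ((q₁ * b₂ - q₂ * b₁ * e ^ 2) * (z / e * Ua)) = -b₁ * (z / e * Ua) := by
    rw [neg_mul, ← mul_assoc, div_mul_cancel₀ _ hd, neg_mul]
  rw [h5, h3, h6, h4]
  field_simp

/-- Both choices of z are handled at once. `hsq` keeps the transformed flux bounded, and `hdec` says
that e^{-z²T} overcomes the growth of the other factors in the remainder. -/
theorem IsSolution.tendsto_log_indicatorFn {γ : ℝ → ℝ} {ρ a M T : ℝ} {u ux : ℝ → ℝ → ℝ}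
    {f₀ f₁ : ℝ → ℝ} (hs : IsSolution γ ρ a T u ux f₀ f₁) (ha : 0 < a) (haM : a ≤ M) (hT : 0 < T)
    (hγ : ContDiffOn ℝ 2 γ (Icc 0 M)) (hγpos : ∀ x ∈ Icc 0 M, 0 < γ x) {Ψ : ℂ → ℝ → ℂ}
    (hΨ : IsSpecialFamily γ M Ψ) {z : ℝ → ℂ} {c δ C μ : ℝ} (hc : 0 < c) (hδ : 0 < δ) (hC : 0 < C)
    (hre : ∀ᶠ τ in atTop, (z τ).re = -(c * τ)) (hsq : ∀ᶠ τ in atTop, 0 ≤ ((z τ) ^ 2).re)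
    (hdec : ∀ᶠ τ in atTop, -(((z τ) ^ 2).re * T) + 2 * (c * τ) * travelTime γ M ≤ -δ * τ)
    (hflux : ∀ᶠ τ in atTop,
      C * τ ^ μ ≤ ‖∫ t in (0 : ℝ)..T, Complex.exp (-(z τ) ^ 2 * t) * (f₀ t : ℂ)‖) :
    Tendsto (fun τ => Real.log ‖indicatorFn γ M T Ψ u f₀ (z τ)‖ / τ) atTop
      (𝓝 (-2 * c * travelTime γ a)) := by
  have hM : 0 < M := ha.trans_le haM
  have m0 : (0 : ℝ) ∈ Icc 0 M := left_mem_Icc.2 hM.le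
  have mM : M ∈ Icc 0 M := right_mem_Icc.2 hM.le
  have ma : a ∈ Icc 0 M := ⟨ha.le, haM⟩
  have hγc := hγ.continuousOn
  have hsub : Icc 0 a ⊆ Icc 0 M := Icc_subset_Icc_right haM
  have hθm := travelTime_strictMonoOn hγc hγpos
  have hθa : 0 < travelTime γ a := by
    simpa [travelTime_zero] using hθm m0 ma ha
  have hθ0 : ∀ x ∈ Icc 0 M, 0 ≤ travelTime γ x := fun x hx => by
    simpa [travelTime_zero] using hθm.monotoneOn m0 hx hx.1
  have hθM : ∀ x ∈ Icc 0 M, travelTime γ x ≤ travelTime γ M := fun x hx =>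
    hθm.monotoneOn hx mM hx.2
  have hreneg : ∀ᶠ τ in atTop, (z τ).re ≤ 0 := by
    filter_upwards [hre, eventually_ge_atTop 0] with τ h hτ
    rw [h]
    nlinarith
  have hz : Tendsto (fun τ => ‖z τ‖) atTop atTop := by
    refine tendsto_atTop_mono' atTop ?_ (tendsto_id.const_mul_atTop hc)
    filter_upwards [hre] with τ h
    have := (neg_le_abs _).trans (Complex.abs_re_le_norm (z τ))
    rw [h] at this
    simpa using this
  have hz' : Tendsto (fun τ => ‖-z τ‖) atTop atTop := by simpa using hz
  have hz0 : ∀ᶠ τ in atTop, z τ ≠ 0 :=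
    (hz.eventually_gt_atTop 0).mono fun _ h => norm_pos_iff.1 h
  obtain ⟨K₁, R₁, -, hwkb₁⟩ := hΨ.exists_isWKBMode hM hγ hγpos
  obtain ⟨K₂, R₂, -, hwkb₂⟩ := exists_growing_modes hM hγ hγpos
  choose! Φ p₂ hwkb₂ using hwkb₂
  set p₁ : ℂ → ℝ → ℂ := fun z x => γ x * derivWithin (Ψ z) (Icc 0 M) x with hp₁
  have hy₁ : ∀ᶠ τ in atTop, IsWKBMode γ M K₁ (z τ) (Ψ (z τ)) (p₁ (z τ)) := by
    filter_upwards [hreneg, hz.eventually_ge_atTop R₁] with τ h h' using hwkb₁ _ h h'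
  have hy₂ : ∀ᶠ τ in atTop, IsWKBMode γ M K₂ (-z τ) (Φ (z τ)) (p₂ (z τ)) := by
    filter_upwards [hreneg, hz.eventually_ge_atTop R₂] with τ h h' using hwkb₂ _ h h'
  set e : ℝ → ℂ := fun τ => Complex.exp (z τ * travelTime γ a) with he
  have hexp : ∀ τ, e τ ≠ 0 := fun τ => Complex.exp_ne_zero _
  have hnorme : ∀ᶠ τ in atTop, ‖e τ‖ = Real.exp (-(c * τ) * travelTime γ a) := by
    filter_upwards [hre] with τ h
    rw [he, Complex.norm_exp, ← h]
    simp
  have he0 : Tendsto e atTop (𝓝 0) := by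
    rw [tendsto_zero_iff_norm_tendsto_zero]
    have h1 : Tendsto (fun τ : ℝ => Real.exp (-((c * travelTime γ a) * τ))) atTop (𝓝 0) :=
      Real.tendsto_exp_neg_atTop_nhds_zero.comp (tendsto_id.const_mul_atTop (mul_pos hc hθa))
    refine h1.congr' ?_
    filter_upwards [hnorme] with τ h
    rw [h]
    congr 1
    ring
  have hr0 : ∀ s : ℝ, ((γ 0 ^ s : ℝ) : ℂ) ≠ 0 := fun s =>
    Complex.ofReal_ne_zero.2 (Real.rpow_pos_of_pos (hγpos 0 m0) _).ne'
  have hra : ∀ s : ℝ, ((γ a ^ s : ℝ) : ℂ) ≠ 0 := fun s =>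
    Complex.ofReal_ne_zero.2 (Real.rpow_pos_of_pos (hγpos a ma) _).ne'
  have ly₁ := tendsto_mode_div_exp hγpos hz hy₁ m0
  have ly₂ := tendsto_mode_div_exp hγpos hz' hy₂ m0
  have lq₁ := tendsto_flux_div_exp hγpos hz hy₁ m0
  have lq₂ := tendsto_flux_div_exp hγpos hz' hy₂ m0
  have lb₁ := tendsto_robin_div_exp hγpos hz hy₁ ma ρ
  have lb₂ := tendsto_robin_div_exp hγpos hz' hy₂ ma ρ
  simp only [travelTime_zero, Complex.ofReal_zero, mul_zero, Complex.exp_zero, div_one,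
    mul_one] at ly₁ ly₂ lq₁ lq₂
  set q₁ : ℝ → ℂ := fun τ => p₁ (z τ) 0 / z τ with hq₁
  set q₂ : ℝ → ℂ := fun τ => p₂ (z τ) 0 / -z τ with hq₂
  set b₁ : ℝ → ℂ := fun τ => (p₁ (z τ) a + ρ * Ψ (z τ) a) /
    (z τ * Complex.exp (z τ * travelTime γ a)) with hb₁
  set b₂ : ℝ → ℂ := fun τ => (p₂ (z τ) a + ρ * Φ (z τ) a) /
    (-z τ * Complex.exp (-z τ * travelTime γ a)) with hb₂
  set d : ℝ → ℂ := fun τ => q₁ τ * b₂ τ - q₂ τ * b₁ τ * e τ ^ 2 with hd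
  -- The second product in d carries e², which tends to 0, so d inherits a nonzero limit from q₁b₂.
  have ld : Tendsto d atTop (𝓝 (((γ 0 ^ (1 / 4 : ℝ) : ℝ) : ℂ) * ((γ a ^ (1 / 4 : ℝ) : ℝ) : ℂ))) := by
    have := (lq₁.mul lb₂).sub ((lq₂.mul lb₁).mul (he0.pow 2))
    rwa [zero_pow two_ne_zero, mul_zero, sub_zero] at this
  have hdlim := mul_ne_zero (hr0 (1 / 4)) (hra (1 / 4))
  have hd0 : ∀ᶠ τ in atTop, d τ ≠ 0 := ld.eventually_ne hdlim
  have lbd := (lb₁.div ld hdlim).neg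
  simp only [Pi.div_apply] at lbd
  have lQ := (lbd.mul_const (γ 0 : ℂ)).mul ((lq₂.mul ly₁).add (lq₁.mul ly₂))
  -- The limit of Q is nonzero because q₂y₁ and q₁y₂ tend to the same value and are added.
  have hQne : -(((γ a ^ (1 / 4 : ℝ) : ℝ) : ℂ) /
      (((γ 0 ^ (1 / 4 : ℝ) : ℝ) : ℂ) * ((γ a ^ (1 / 4 : ℝ) : ℝ) : ℂ))) * (γ 0 : ℂ) *
      (((γ 0 ^ (1 / 4 : ℝ) : ℝ) : ℂ) * ((γ 0 ^ (-(1 / 4) : ℝ) : ℝ) : ℂ) +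
        ((γ 0 ^ (1 / 4 : ℝ) : ℝ) : ℂ) * ((γ 0 ^ (-(1 / 4) : ℝ) : ℝ) : ℂ)) ≠ 0 := by
    refine mul_ne_zero (mul_ne_zero (neg_ne_zero.2 (div_ne_zero (hra _) hdlim))
      (Complex.ofReal_ne_zero.2 (hγpos 0 m0).ne')) ?_
    rw [← two_mul]
    exact mul_ne_zero two_ne_zero (mul_ne_zero (hr0 _) (hr0 _))
  set E₁ : ℝ → ℂ := fun τ => Complex.exp (-(z τ) ^ 2 * T) *
    ∫ x in Ioo 0 a, (u x T : ℂ) * Ψ (z τ) x with hE₁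
  set E₂ : ℝ → ℂ := fun τ => Complex.exp (-(z τ) ^ 2 * T) *
    ∫ x in Ioo 0 a, (u x T : ℂ) * Φ (z τ) x with hE₂
  have huT : IntegrableOn (fun x => u x T) (Ioo 0 a) :=
    integrableOn_of_memLp_two (hs.memLp_slice T (right_mem_Icc.2 hT.le))
  obtain ⟨C₁, hC₁, hn₁⟩ := exists_norm_mode_le hγc hγpos hz hy₁
  obtain ⟨C₂, hC₂, hn₂⟩ := exists_norm_mode_le hγc hγpos hz' hy₂
  set N := ∫ x in Ioo 0 a, ‖u x T‖ with hN
  have hN0 : 0 ≤ N := integral_nonneg fun _ => norm_nonneg _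
  have hnX : ∀ τ, ‖Complex.exp (-(z τ) ^ 2 * T)‖ = Real.exp (-(((z τ) ^ 2).re * T)) := fun τ => by
    rw [Complex.norm_exp]
    congr 1
    simp
  have hE₁n : ∀ᶠ τ in atTop, ‖E₁ τ‖ ≤ C₁ * N * Real.exp (-(((z τ) ^ 2).re * T)) := by
    filter_upwards [hn₁, hreneg] with τ h h'
    rw [hE₁, norm_mul, hnX, mul_comm]
    gcongr
    refine norm_pairing_le haM huT fun x hx => (h x hx).trans ?_
    refine mul_le_of_le_one_right hC₁ ?_
    rw [Real.exp_le_one_iff]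
    exact mul_nonpos_of_nonpos_of_nonneg h' (hθ0 x hx)
  have hE₂n : ∀ᶠ τ in atTop, ‖E₂ τ‖ ≤ C₂ * N *
      (Real.exp (-(((z τ) ^ 2).re * T)) * Real.exp (c * τ * travelTime γ M)) := by
    filter_upwards [hn₂, hre, eventually_ge_atTop 0] with τ h h' hτ
    have h1 : ‖∫ x in Ioo 0 a, (u x T : ℂ) * Φ (z τ) x‖ ≤
        C₂ * Real.exp (c * τ * travelTime γ M) * N := by
      refine norm_pairing_le haM huT fun x hx => (h x hx).trans ?_
      rw [Complex.neg_re, h', neg_neg]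
      gcongr
      exact hθM x hx
    rw [hE₂, norm_mul, hnX]
    calc _ ≤ Real.exp (-(((z τ) ^ 2).re * T)) * (C₂ * Real.exp (c * τ * travelTime γ M) * N) := by
          gcongr
      _ = _ := by ring
  have hθM0 := hθ0 M mM
  have oE₁ : E₁ =O[atTop] fun τ => Real.exp (-δ * τ) := by
    refine Asymptotics.IsBigO.of_bound (C₁ * N) ?_
    filter_upwards [hE₁n, hdec, eventually_ge_atTop 0] with τ h h' hτ
    rw [Real.norm_of_nonneg (Real.exp_pos _).le]
    refine h.trans ?_
    gcongr
    have : 0 ≤ 2 * (c * τ) * travelTime γ M := by positivity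
    linarith
  have oE₂ : E₂ =O[atTop] fun τ => Real.exp (-δ * τ) := by
    refine Asymptotics.IsBigO.of_bound (C₂ * N) ?_
    filter_upwards [hE₂n, hdec, eventually_ge_atTop 0] with τ h h' hτ
    rw [Real.norm_of_nonneg (Real.exp_pos _).le]
    refine h.trans ?_
    rw [← Real.exp_add]
    gcongr
    have : 0 ≤ c * τ * travelTime γ M := by positivity
    linarith
  -- This term needs the factor 2 in `hdec`: dividing by e² costs e^{2cτθ(a)}, and a ≤ M. The growth
  -- of Φ in E₂ costs only e^{cτθ(M)}.
  have oE₁e : (fun τ => E₁ τ / e τ ^ 2) =O[atTop] fun τ => Real.exp (-δ * τ) := by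
    refine Asymptotics.IsBigO.of_bound (C₁ * N) ?_
    filter_upwards [hE₁n, hdec, hnorme, eventually_ge_atTop 0] with τ h h' hne hτ
    rw [Real.norm_of_nonneg (Real.exp_pos _).le, norm_div, norm_pow, hne, div_le_iff₀ (by positivity)]
    refine h.trans ?_
    rw [mul_assoc (C₁ * N), ← Real.exp_nat_mul, ← Real.exp_add]
    gcongr
    have h1 : c * τ * travelTime γ a ≤ c * τ * travelTime γ M := by
      gcongr
      exact hθM a ma
    push_cast
    linarith
  have or : (fun τ => -(b₁ τ / d τ) * (q₂ τ * E₁ τ + q₁ τ * E₂ τ) - E₁ τ / e τ ^ 2)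
      =O[atTop] fun τ => Real.exp (-δ * τ) := by
    have o1 := (lq₂.isBigO_one ℝ).mul oE₁
    have o2 := (lq₁.isBigO_one ℝ).mul oE₂
    have o3 := (lbd.isBigO_one ℝ).mul (o1.add (by simpa using o2))
    simpa using o3.sub (by simpa using oE₁e)
  have hFle : ∀ᶠ τ in atTop, ‖∫ t in (0 : ℝ)..T, Complex.exp (-(z τ) ^ 2 * t) * (f₀ t : ℂ)‖ ≤
      ∫ t in Ioo 0 T, ‖f₀ t‖ :=
    hsq.mono fun τ h => norm_laplace_le hT.le (integrableOn_of_memLp_two hs.memLp_flux_zero) h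
  obtain ⟨hJne, hJ⟩ := tendsto_log_norm_div hQne hC hδ lQ hflux hFle or
  have hIJ : ∀ᶠ τ in atTop, indicatorFn γ M T Ψ u f₀ (z τ) / e τ ^ 2 =
      -(b₁ τ / d τ) * γ 0 * (q₂ τ * Ψ (z τ) 0 + q₁ τ * Φ (z τ) 0) *
        (∫ t in (0 : ℝ)..T, Complex.exp (-(z τ) ^ 2 * t) * (f₀ t : ℂ)) +
      (-(b₁ τ / d τ) * (q₂ τ * E₁ τ + q₁ τ * E₂ τ) - E₁ τ / e τ ^ 2) := by
    filter_upwards [hy₁, hy₂, hd0, hz0, hreneg] with τ h1 h2 h3 h4 h5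
    have hinv : Complex.exp (-z τ * travelTime γ a) = (e τ)⁻¹ := by
      rw [he, ← Complex.exp_neg, neg_mul]
    have eq1 : p₁ (z τ) 0 = z τ * q₁ τ := by rw [hq₁]; field_simp
    have eq2 : p₂ (z τ) 0 = -z τ * q₂ τ := by rw [hq₂]; field_simp
    have eb1 : p₁ (z τ) a + ρ * Ψ (z τ) a = z τ * e τ * b₁ τ :=
      (mul_div_cancel₀ _ (mul_ne_zero h4 (hexp τ))).symm
    have eb2 : p₂ (z τ) a + ρ * Φ (z τ) a = -z τ * (e τ)⁻¹ * b₂ τ := by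
      rw [← hinv]
      exact (mul_div_cancel₀ _ (mul_ne_zero (neg_ne_zero.2 h4) (Complex.exp_ne_zero _))).symm
    have id1 := hs.laplace_identity ha hT (hγc.mono hsub) (fun x hx => hγpos x (hsub hx))
      (h1.toIsMode.mono haM)
    have id2 := hs.laplace_identity ha hT (hγc.mono hsub) (fun x hx => hγpos x (hsub hx))
      (h2.toIsMode.mono haM)
    have id3 := indicatorFn_eq hs ha hM hT
      ((hΨ.contDiffOn (z τ) h5).differentiableOn (by norm_num))
    rw [eb1, eq1] at id1
    -- Since (-z)² = z², the growing mode is paired with the same time factor and the same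
    -- transforms F, U₀, U_a.
    rw [eb2, eq2, neg_sq] at id2
    change _ = -p₁ (z τ) 0 * _ + _ at id3
    rw [eq1] at id3
    exact indicator_elimination (hexp τ) h3 id1 id2 id3
  -- Undoing the division by e² adds log|e|² = -2cτθ(a), which after division by τ is the asserted
  -- limit.
  have hfinal : ∀ᶠ τ in atTop, Real.log ‖-(b₁ τ / d τ) * γ 0 *
      (q₂ τ * Ψ (z τ) 0 + q₁ τ * Φ (z τ) 0) *
        (∫ t in (0 : ℝ)..T, Complex.exp (-(z τ) ^ 2 * t) * (f₀ t : ℂ)) +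
      (-(b₁ τ / d τ) * (q₂ τ * E₁ τ + q₁ τ * E₂ τ) - E₁ τ / e τ ^ 2)‖ / τ +
      -2 * c * travelTime γ a = Real.log ‖indicatorFn γ M T Ψ u f₀ (z τ)‖ / τ := by
    filter_upwards [hIJ, hJne, hnorme, eventually_gt_atTop 0] with τ h1 h2 h3 hτ
    rw [← h1] at h2 ⊢
    have h4 : indicatorFn γ M T Ψ u f₀ (z τ) ≠ 0 := fun h => h2 (by rw [h, zero_div])
    rw [norm_div, Real.log_div (norm_ne_zero_iff.2 h4)
      (norm_ne_zero_iff.2 (pow_ne_zero 2 (hexp τ))), norm_pow, h3, Real.log_pow, Real.log_exp]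
    push_cast
    field_simp
    ring
  have := (hJ.add_const (-2 * c * travelTime γ a)).congr' hfinal
  rwa [zero_add] at this

/-! ### The two choices of z -/

theorem FluxLowerBound.eventually {T : ℝ} {f : ℝ → ℝ} {z : ℝ → ℂ} {τmin : ℝ}
    (h : FluxLowerBound T f z τmin) : ∃ C μ : ℝ, 0 < C ∧ ∀ᶠ τ in atTop,
      C * τ ^ μ ≤ ‖∫ t in (0 : ℝ)..T, Complex.exp (-(z τ) ^ 2 * t) * (f t : ℂ)‖ := by
  obtain ⟨C, τ₀, μ, hC, -, h⟩ := h
  exact ⟨C, μ, hC, (eventually_gt_atTop τ₀).mono h⟩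

theorem zOf_re (c τ : ℝ) : (zOf c τ).re = -(c * τ) := by
  simp [zOf]

/-- The imaginary part of z is chosen so that (Re z)² - (Im z)² = τ: thus e^{-z²T} decays only like
e^{-τT}, on the same scale as the modes, which is why T > 2cθ(M) is required. -/
theorem zOf_sq_re {c τ : ℝ} (hc : 0 < c) (hτ : 1 / c ^ 2 < τ) : ((zOf c τ) ^ 2).re = τ := by
  have hτ0 : 0 < τ := lt_trans (by positivity) hτ
  have h1 : 0 ≤ 1 - 1 / (c ^ 2 * τ) := by
    rw [sub_nonneg, div_le_one (by positivity)]
    rw [div_lt_iff₀ (by positivity)] at hτ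
    linarith
  have h2 := Real.sq_sqrt h1
  have h3 : ((zOf c τ) ^ 2).re =
      c ^ 2 * τ ^ 2 - c ^ 2 * τ ^ 2 * √(1 - 1 / (c ^ 2 * τ)) ^ 2 := by
    simp [zOf, sq]
    ring
  rw [h3, h2]
  field_simp
  ring

section

variable {γ : ℝ → ℝ} {ρ a M T : ℝ} {u ux : ℝ → ℝ → ℝ} {f₀ f₁ : ℝ → ℝ} {Ψ : ℂ → ℝ → ℂ}

theorem IsSolution.tendsto_log_indicatorFn_zOf (hs : IsSolution γ ρ a T u ux f₀ f₁) (ha : 0 < a)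
    (haM : a ≤ M) (hT : 0 < T) (hγ : ContDiffOn ℝ 2 γ (Icc 0 M)) (hγpos : ∀ x ∈ Icc 0 M, 0 < γ x)
    (hΨ : IsSpecialFamily γ M Ψ) {c : ℝ} (hc : 0 < c) (hcT : 2 * c * travelTime γ M < T)
    (hflux : FluxLowerBound T f₀ (zOf c) (1 / c ^ 2)) :
    Tendsto (fun τ => Real.log ‖indicatorFn γ M T Ψ u f₀ (zOf c τ)‖ / τ) atTop
      (𝓝 (-2 * c * travelTime γ a)) := by
  obtain ⟨C, μ, hC, h⟩ := hflux.eventually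
  -- The remainder decays at the rate δ = T - 2cθ(M).
  refine hs.tendsto_log_indicatorFn ha haM hT hγ hγpos hΨ hc (sub_pos.2 hcT) hC
    (Eventually.of_forall (zOf_re c)) ?_ ?_ h
  · filter_upwards [eventually_gt_atTop (1 / c ^ 2)] with τ hτ
    rw [zOf_sq_re hc hτ]
    exact le_trans (by positivity) hτ.le
  · filter_upwards [eventually_gt_atTop (1 / c ^ 2)] with τ hτ
    rw [zOf_sq_re hc hτ]
    linarith

theorem IsSolution.tendsto_log_indicatorFn_neg (hs : IsSolution γ ρ a T u ux f₀ f₁) (ha : 0 < a)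
    (haM : a ≤ M) (hT : 0 < T) (hγ : ContDiffOn ℝ 2 γ (Icc 0 M)) (hγpos : ∀ x ∈ Icc 0 M, 0 < γ x)
    (hΨ : IsSpecialFamily γ M Ψ) (hflux : FluxLowerBound T f₀ (fun τ => -(τ : ℂ)) 0) :
    Tendsto (fun τ : ℝ => Real.log ‖indicatorFn γ M T Ψ u f₀ (-(τ : ℂ))‖ / τ) atTop
      (𝓝 (-2 * travelTime γ a)) := by
  obtain ⟨C, μ, hC, h⟩ := hflux.eventually
  have hre : ∀ τ : ℝ, ((-(τ : ℂ)) ^ 2).re = τ ^ 2 := fun τ => by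
    rw [neg_sq, ← Complex.ofReal_pow, Complex.ofReal_re]
  have := hs.tendsto_log_indicatorFn ha haM hT hγ hγpos hΨ one_pos one_pos hC
    (Eventually.of_forall fun τ => by simp)
    (Eventually.of_forall fun τ => by rw [hre]; positivity) ?_ h
  · rwa [mul_one] at this
  -- Here Re z² = τ² dominates any linear exponent, so no condition on T is needed; the threshold is
  -- where τT ≥ 1 + 2θ(M), giving δ = 1.
  · filter_upwards [eventually_ge_atTop 0,
      eventually_ge_atTop ((1 + 2 * travelTime γ M) / T)] with τ h0 h1
    rw [div_le_iff₀ hT] at h1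
    rw [hre]
    nlinarith

end

/-! ### Dependence on the boundary data only, and the main theorem -/

theorem intervalIntegral_congr_of_ae_Ioo {T : ℝ} (hT : 0 ≤ T) {f g : ℝ → ℂ}
    (h : ∀ᵐ t ∂(volume.restrict (Ioo 0 T)), f t = g t) :
    ∫ t in (0 : ℝ)..T, f t = ∫ t in (0 : ℝ)..T, g t := by
  rw [← setIntegral_Ioo_eq hT, ← setIntegral_Ioo_eq hT]
  exact integral_congr_ae h

theorem FluxLowerBound.congr {T : ℝ} (hT : 0 ≤ T) {f g : ℝ → ℝ} {z : ℝ → ℂ} {τmin : ℝ}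
    (h : FluxLowerBound T f z τmin) (hfg : ∀ᵐ t ∂(volume.restrict (Ioo 0 T)), f t = g t) :
    FluxLowerBound T g z τmin := by
  obtain ⟨C, τ₀, μ, hC, hτ₀, h⟩ := h
  refine ⟨C, τ₀, μ, hC, hτ₀, fun τ hτ => (h τ hτ).trans_eq ?_⟩
  rw [intervalIntegral_congr_of_ae_Ioo hT]
  filter_upwards [hfg] with t ht
  rw [ht]

theorem indicatorFn_congr {γ : ℝ → ℝ} {M T : ℝ} (hT : 0 ≤ T) {Ψ : ℂ → ℝ → ℂ} {u v : ℝ → ℝ → ℝ}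
    {f g : ℝ → ℝ} (h : ∀ᵐ t ∂(volume.restrict (Ioo 0 T)), u 0 t = v 0 t ∧ f t = g t) (z : ℂ) :
    indicatorFn γ M T Ψ u f z = indicatorFn γ M T Ψ v g z := by
  refine intervalIntegral_congr_of_ae_Ioo hT ?_
  filter_upwards [h] with t ht
  rw [ht.1, ht.2]

end HeatEnclosure

theorem theorem2p5 (M T : ℝ) (hM : 0 < M) (hT : 0 < T) (γ : ℝ → ℝ)
    (hγ : ContDiffOn ℝ 2 γ (Set.Icc 0 M)) (hγpos : ∀ x ∈ Set.Icc 0 M, 0 < γ x) :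
    -- the special solutions exist
    (∃ Ψ : ℂ → ℝ → ℂ, HeatEnclosure.IsSpecialFamily γ M Ψ) ∧
    -- the two extraction formulae
    (∀ Ψ : ℂ → ℝ → ℂ, HeatEnclosure.IsSpecialFamily γ M Ψ →
      ∀ (a ρ : ℝ) (u ux : ℝ → ℝ → ℝ) (f₀ f₁ : ℝ → ℝ), 0 < a → a ≤ M → 0 ≤ ρ →
        HeatEnclosure.IsSolution γ ρ a T u ux f₀ f₁ →
        (∀ c : ℝ, 0 < c → 2 * c * HeatEnclosure.travelTime γ M < T →
          HeatEnclosure.FluxLowerBound T f₀ (HeatEnclosure.zOf c) (1 / c ^ 2) →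
          Filter.Tendsto
            (fun τ : ℝ => Real.log
              ‖HeatEnclosure.indicatorFn γ M T Ψ u f₀ (HeatEnclosure.zOf c τ)‖ / τ)
            Filter.atTop (nhds (-2 * c * HeatEnclosure.travelTime γ a))) ∧
        (HeatEnclosure.FluxLowerBound T f₀ (fun τ => -(τ : ℂ)) 0 →
          Filter.Tendsto
            (fun τ : ℝ => Real.log
              ‖HeatEnclosure.indicatorFn γ M T Ψ u f₀ (-(τ : ℂ))‖ / τ)
            Filter.atTop (nhds (-2 * HeatEnclosure.travelTime γ a)))) ∧
    -- uniqueness of the endpoint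
    (∀ (a₁ a₂ ρ₁ ρ₂ : ℝ) (u₁ u₂ ux₁ ux₂ : ℝ → ℝ → ℝ) (f₁ f₂ h₁ h₂ : ℝ → ℝ),
      0 < a₁ → a₁ ≤ M → 0 < a₂ → a₂ ≤ M → 0 ≤ ρ₁ → 0 ≤ ρ₂ →
      HeatEnclosure.IsSolution γ ρ₁ a₁ T u₁ ux₁ f₁ h₁ →
      HeatEnclosure.IsSolution γ ρ₂ a₂ T u₂ ux₂ f₂ h₂ →
      (∀ᵐ t ∂(MeasureTheory.volume.restrict (Set.Ioo 0 T)), u₁ 0 t = u₂ 0 t ∧ f₁ t = f₂ t) →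
      ((∃ c : ℝ, 0 < c ∧ 2 * c * HeatEnclosure.travelTime γ M < T ∧
          HeatEnclosure.FluxLowerBound T f₁ (HeatEnclosure.zOf c) (1 / c ^ 2)) ∨
        HeatEnclosure.FluxLowerBound T f₁ (fun τ => -(τ : ℂ)) 0) →
      a₁ = a₂) := by
  refine ⟨HeatEnclosure.exists_isSpecialFamily hM hγ hγpos, ?_, ?_⟩
  · intro Ψ hΨ a ρ u ux f₀ f₁ ha haM _ hs
    exact ⟨fun c hc hcT hflux =>
      hs.tendsto_log_indicatorFn_zOf ha haM hT hγ hγpos hΨ hc hcT hflux,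
      fun hflux => hs.tendsto_log_indicatorFn_neg ha haM hT hγ hγpos hΨ hflux⟩
  · intro a₁ a₂ ρ₁ ρ₂ u₁ u₂ ux₁ ux₂ f₁ f₂ h₁ h₂ ha₁ haM₁ ha₂ haM₂ _ _ hs₁ hs₂ heq hflux
    -- The family depends on γ and M alone, so one Ψ serves both solutions and their indicator
    -- functions coincide.
    obtain ⟨Ψ, hΨ⟩ := HeatEnclosure.exists_isSpecialFamily hM hγ hγpos
    have hI := HeatEnclosure.indicatorFn_congr (γ := γ) (M := M) (Ψ := Ψ) hT.le heq
    have hf := heq.mono fun t ht => ht.2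
    refine (HeatEnclosure.travelTime_strictMonoOn hγ.continuousOn hγpos).injOn
      ⟨ha₁.le, haM₁⟩ ⟨ha₂.le, haM₂⟩ ?_
    rcases hflux with ⟨c, hc, hcT, hflux⟩ | hflux
    · have l₁ := hs₁.tendsto_log_indicatorFn_zOf ha₁ haM₁ hT hγ hγpos hΨ hc hcT hflux
      have l₂ := hs₂.tendsto_log_indicatorFn_zOf ha₂ haM₂ hT hγ hγpos hΨ hc hcT
        (hflux.congr hT.le hf)
      simp only [hI] at l₁
      exact mul_left_cancel₀ (by simp [hc.ne']) (tendsto_nhds_unique l₁ l₂)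
    · have l₁ := hs₁.tendsto_log_indicatorFn_neg ha₁ haM₁ hT hγ hγpos hΨ hflux
      have l₂ := hs₂.tendsto_log_indicatorFn_neg ha₂ haM₂ hT hγ hγpos hΨ (hflux.congr hT.le hf)
      simp only [hI] at l₁
      exact mul_left_cancel₀ (by norm_num) (tendsto_nhds_unique l₁ l₂)
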